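/- A \emph{relation algebra} is a Boolean algebra $(A,+,-)$ with a binary operation $;$, a unary operation ${}^{\smile}$ and a constant $1'$ such that, for all $r,s,t$: $r;(s;t)=(r;s);t$, $r;1'=r$, $r^{\smile\smile}=r$, $(r;s)^\smile=s^\smile;r^\smile$, $(r+s);t=r;t+s;t$, $(r+s)^\smile=r^\smile+s^\smile$, and $r^\smile;-(r;s)\le -s$. A \emph{function} is an element $f$ with $f^\smile;f\le 1'$. An atom $x\le 1'$ is \emph{measurable} if $x;1;x$ is the sum of a set of functions, and a relation algebra is \emph{measurable} if $1'$ is the sum of a set of measurable atoms. A \emph{completion} of a relation algebra $\mathfrak B$ is a complete relation algebra $\mathfrak A$ with an embedding of $\mathfrak B$ into $\mathfrak A$ such that every non-zero element of $\mathfrak A$ is above the image of a non-zero element of $\mathfrak B$. For a measurable atom $x$ of a relation algebra $\mathfrak A$, let $G_x$ be the group, under $;$ and ${}^\smile$ and with identity $x$, of non-zero functions below $x;1;x$. Let $I$ be the set of measurable atoms and $\mathcal E=\{(x,y)\in I\times I: x;1;y\ne 0\}$. A \emph{semi-scaffold} is a system $\langle a_{xy}:(x,y)\in\mathcal E\rangle$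 of atoms with $a_{xy}\le x;1;y$, $a_{xx}=x$, $a_{yx}=a_{xy}^\smile$. A \emph{group triple} $\mathcal F=(G,\varphi,C)$ consists of disjoint groups $G_x$ ($x\in I$), an equivalence relation $\mathcal E$ on $I$, for each $(x,y)\in\mathcal E$ an isomorphism $\varphi_{xy}:G_x/H_{xy}\to G_y/K_{xy}$ with $H_{xy},K_{xy}$ normal subgroups, and, whenever $(x,y),(y,z)\in\mathcal E$, a coset $C_{xyz}$ of $H_{xy}H_{xz}$ in $G_x$. For a union $M$ of cosets of $H_{xy}$, $\varphi_{xy}[M]$ is the union of the images of these cosets. The triple is a \emph{semi-frame} if, for all $(x,y),(y,z)\in\mathcal E$: (i) $H_{xx}$ and $K_{xx}$ are trivial and $\varphi_{xx}$ is the identity; (ii) $\varphi_{yx}=\varphi_{xy}^{-1}$ (so $H_{yx}=K_{xy}$, $K_{yx}=H_{xy}$); (iii) $\varphi_{xy}[H_{xy}H_{xz}]=K_{xy}H_{yz}$; (iv) $\varphi_{yz}[\varphi_{xy}[M]]=\varphi_{xz}[C_{xyz}^{-1}MC_{xyz}]$ for every coset $M$ of $H_{xy}H_{xz}$. The algebra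 $\mathfrak C[\mathcal F]$ of a semi-frame $\mathcal F$ consists of all unions of sets of the binary relations $$R_{xy,\alpha}=\bigcup\{\xi\times(\varphi_{xy}(\xi)\varphi_{xy}(\alpha)):\xi\in G_x/H_{xy}\}\qquad((x,y)\in\mathcal E,\ \alpha\in G_x/H_{xy}),$$ with union, complement in the union of all $R_{xy,\alpha}$, converse of relations, the identity relation on $\bigcup_xG_x$, and the operation $\otimes$ that is completely distributive over unions and satisfies $R_{xy,\alpha}\otimes R_{wz,\beta}=\varnothing$ for $y\ne w$ and $$R_{xy,\alpha}\otimes R_{yz,\beta}=\bigcup\{R_{xz,\gamma}:\gamma\subseteq\varphi_{xy}^{-1}[\varphi_{xy}(\alpha)\,\beta]\,C_{xyz}\}.$$ It is called a \emph{coset relation algebra} if it is a relation algebra. A group triple is \emph{associated with a semi-scaffold} $a$ in $\mathfrak A$ if its groups are the $G_x$ and its relation is the $\mathcal E$ defined above from $\mathfrak A$, $H_{xy}=\{f\in G_x:f;a_{xy}=a_{xy}\}$, $K_{xy}=\{g\in G_y:a_{xy};g=a_{xy}\}$, $\varphi_{xy}(fH_{xy})=gK_{xy}$ if and only if $f;a_{xy}=a_{xy};g$,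 and $C_{xyz}=H_{xy}\,fH_{xz}$ for some $f\in G_x$ with $f;a_{xz}\le a_{xy};a_{yz}$. \textbf{Theorem (Representation Theorem).} Every atomic, measurable relation algebra $\mathfrak B$ is essentially isomorphic to a coset relation algebra. In detail: $\mathfrak B$ has a completion; every completion $\mathfrak A$ of $\mathfrak B$ has a semi-scaffold; and for every semi-scaffold $a$ in $\mathfrak A$ there is a group triple associated with $a$, and every such triple $\mathcal F$ is a semi-frame, $\mathfrak C[\mathcal F]$ is a (coset) relation algebra, and there is an isomorphism from $\mathfrak A$ to $\mathfrak C[\mathcal F]$ that maps $f;a_{xy}$ to $R_{xy,fH_{xy}}$ for all $(x,y)\in\mathcal E$ and $f\in G_x$. -/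

import Mathlib

open scoped Pointwise

universe u v

/-! ## Relation algebras -/

/-- The non-Boolean operations of a relation algebra: relative multiplication, converse and
the identity element. -/
class RelOps (A : Type u) where
  rmul : A → A → A
  conv : A → A
  ident : A

infixl:70 "⨾" => RelOps.rmul
postfix:max "˘" => RelOps.conv

/-- `A` is a relation algebra: a Boolean algebra together with a relative multiplication,
a converse and an identity element satisfying Tarski's axioms. -/
class IsRelationAlgebra (A : Type u) [BooleanAlgebra A] [RelOps A] : Prop where
  rmul_assoc : ∀ r s t : A, r ⨾ (s ⨾ t) = (r ⨾ s) ⨾ t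
  rmul_ident : ∀ r : A, r ⨾ RelOps.ident = r
  conv_conv : ∀ r : A, (r˘)˘ = r
  conv_rmul : ∀ r s : A, (r ⨾ s)˘ = s˘ ⨾ r˘
  sup_rmul : ∀ r s t : A, (r ⊔ s) ⨾ t = (r ⨾ t) ⊔ (s ⨾ t)
  conv_sup : ∀ r s : A, (r ⊔ s)˘ = r˘ ⊔ s˘
  tarski : ∀ r s : A, (r˘ ⨾ (r ⨾ s)ᶜ) ⊔ sᶜ = sᶜ

/-- Homomorphisms between algebras of the similarity type of relation algebras. -/
structure IsRAHom {A : Type u} {B : Type v} [BooleanAlgebra A] [RelOps A]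
    [BooleanAlgebra B] [RelOps B] (e : A → B) : Prop where
  map_sup : ∀ r s : A, e (r ⊔ s) = e r ⊔ e s
  map_compl : ∀ r : A, e rᶜ = (e r)ᶜ
  map_rmul : ∀ r s : A, e (r ⨾ s) = e r ⨾ e s
  map_conv : ∀ r : A, e r˘ = (e r)˘
  map_ident : e RelOps.ident = RelOps.ident

/-- `e : B → A` exhibits `A` as a completion (minimal complete extension) of `B`: `A` is a
complete relation algebra in which `B` is embedded as a dense subalgebra. -/
structure IsCompletion {B : Type u} {A : Type v} [BooleanAlgebra B] [RelOps B]
    [BooleanAlgebra A] [RelOps A] (e : B → A) : Prop where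
  relationAlgebra : IsRelationAlgebra A
  complete : ∀ S : Set A, ∃ s, IsLUB S s
  hom : IsRAHom e
  injective : Function.Injective e
  dense : ∀ a : A, a ≠ ⊥ → ∃ b : B, b ≠ ⊥ ∧ e b ≤ a

section Measurable

variable {A : Type u} [BooleanAlgebra A] [RelOps A]

/-- Functional elements. -/
def IsFunctional (f : A) : Prop := f˘ ⨾ f ≤ RelOps.ident

/-- The rectangle `x;1;y` with sides `x` and `y`. -/
def rect (x y : A) : A := x ⨾ ⊤ ⨾ y

/-- Measurable atoms: subidentity atoms `x` whose square `x;1;x` is a sum of functions. -/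
structure IsMeasurableAtom (x : A) : Prop where
  isAtom : IsAtom x
  le_ident : x ≤ RelOps.ident
  square : ∃ S : Set A, (∀ f ∈ S, IsFunctional f) ∧ IsLUB S (rect x x)

variable (A) in
/-- Measurable algebras: the identity element is a sum of measurable atoms. -/
def IsMeasurableAlgebra : Prop :=
  ∃ S : Set A, (∀ x ∈ S, IsMeasurableAtom x) ∧ IsLUB S RelOps.ident

variable (A) in
/-- The set `I` of all measurable atoms. -/
abbrev MAtom : Type u := {x : A // IsMeasurableAtom x}

/-- The relation `ℰ` on measurable atoms: the rectangle `x;1;y` is not zero. -/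
def Linked (x y : MAtom A) : Prop := rect x.1 y.1 ≠ ⊥

/-- The underlying set of the group `G_x`: the non-zero functions below `x;1;x`. -/
def PermGroup (x : MAtom A) : Type u :=
  {f : A // f ≠ ⊥ ∧ IsFunctional f ∧ f ≤ rect x.1 x.1}

/-! ### The group structure of `G_x` -/

namespace RelAlg

variable [IsRelationAlgebra A]

open IsRelationAlgebra

theorem conv_mono {a b : A} (h : a ≤ b) : a˘ ≤ b˘ := by
  rw [← sup_eq_right] at h ⊢
  rw [← conv_sup, h]

theorem rmul_mono_left {a b : A} (c : A) (h : a ≤ b) : a ⨾ c ≤ b ⨾ c := by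
  rw [← sup_eq_right] at h ⊢
  rw [← sup_rmul, h]

theorem rmul_sup (a b c : A) : a ⨾ (b ⊔ c) = (a ⨾ b) ⊔ (a ⨾ c) := by
  rw [← conv_conv (a ⨾ (b ⊔ c)), conv_rmul, conv_sup, sup_rmul, conv_sup]
  simp only [conv_rmul, conv_conv]

theorem rmul_mono_right {a b : A} (c : A) (h : a ≤ b) : c ⨾ a ≤ c ⨾ b := by
  rw [← sup_eq_right] at h ⊢
  rw [← rmul_sup, h]

theorem rmul_mono {a b c d : A} (h : a ≤ b) (h' : c ≤ d) : a ⨾ c ≤ b ⨾ d :=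
  (rmul_mono_left c h).trans (rmul_mono_right b h')

theorem conv_ident : (RelOps.ident : A)˘ = RelOps.ident := by
  have h := conv_rmul ((RelOps.ident : A)˘) RelOps.ident
  rw [rmul_ident, conv_conv, rmul_ident] at h
  exact h.symm

theorem ident_rmul (a : A) : RelOps.ident ⨾ a = a := by
  rw [← conv_conv (RelOps.ident ⨾ a), conv_rmul, conv_ident, rmul_ident, conv_conv]

theorem conv_top : (⊤ : A)˘ = ⊤ := by
  apply top_le_iff.1
  have := conv_mono (le_top : (⊤ : A)˘ ≤ ⊤)
  rwa [conv_conv] at this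

theorem conv_bot : (⊥ : A)˘ = ⊥ := by
  apply le_bot_iff.1
  have := conv_mono (bot_le : ⊥ ≤ (⊥ : A)˘)
  rwa [conv_conv] at this

theorem cycle {a b c : A} (h : (a ⨾ b) ⊓ c = ⊥) : (a˘ ⨾ c) ⊓ b = ⊥ := by
  have h1 : c ≤ (a ⨾ b)ᶜ := by
    rw [le_compl_iff_disjoint_left, disjoint_iff]; exact h
  have h2 : a˘ ⨾ (a ⨾ b)ᶜ ≤ bᶜ := sup_eq_right.1 (tarski a b)
  have h3 := (rmul_mono_right (a˘) h1).trans h2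
  rw [← disjoint_iff]
  exact le_compl_iff_disjoint_right.1 h3

theorem rmul_bot (a : A) : a ⨾ ⊥ = ⊥ := by
  have h : (a˘ ⨾ (⊤ : A)) ⊓ ⊥ = ⊥ := inf_bot_eq _
  have := cycle h
  rwa [conv_conv, inf_top_eq] at this

theorem dedekind (a b c : A) : (a ⨾ b) ⊓ c ≤ a ⨾ (b ⊓ (a˘ ⨾ c)) := by
  have h : b = (b ⊓ (a˘ ⨾ c)) ⊔ (b ⊓ (a˘ ⨾ c)ᶜ) := by
    rw [← inf_sup_left, sup_compl_eq_top, inf_top_eq]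
  have h2 : (a˘ ⨾ c) ⊓ (b ⊓ (a˘ ⨾ c)ᶜ) = ⊥ := by
    rw [inf_left_comm, inf_compl_eq_bot, inf_bot_eq]
  have h3 := cycle h2
  rw [conv_conv] at h3
  conv_lhs => rw [h, rmul_sup, inf_sup_right, h3, sup_bot_eq]
  exact inf_le_left

theorem conv_le_ident {x : A} (hx : x ≤ RelOps.ident) : x˘ ≤ RelOps.ident := by
  have := conv_mono hx
  rwa [conv_ident] at this

theorem le_rmul_self {x : A} (hx : x ≤ RelOps.ident) : x ≤ x ⨾ x := by
  have h := dedekind x RelOps.ident x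
  rw [rmul_ident, inf_idem] at h
  refine h.trans (rmul_mono_right x (inf_le_right.trans ?_))
  have := rmul_mono_left x (conv_le_ident hx)
  rwa [ident_rmul] at this

theorem le_conv {x : A} (hx : x ≤ RelOps.ident) : x ≤ x˘ := by
  have h := dedekind x RelOps.ident x
  rw [rmul_ident, inf_idem] at h
  refine h.trans ((rmul_mono hx inf_le_right).trans ?_)
  rw [ident_rmul]
  have := rmul_mono_right (x˘) hx
  rwa [rmul_ident] at this

theorem conv_eq {x : A} (hx : x ≤ RelOps.ident) : x˘ = x := by
  refine le_antisymm ?_ (le_conv hx)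
  have := le_conv (conv_le_ident hx)
  rwa [conv_conv] at this

theorem rmul_of_le {x : A} (hx : x ≤ RelOps.ident) {f : A} (hf : f ≤ rect x x) : x ⨾ f = f := by
  apply le_antisymm
  · have := rmul_mono_left f hx
    rwa [ident_rmul] at this
  · have h1 : f ≤ x ⨾ ⊤ := by
      refine hf.trans ?_
      rw [rect, ← rmul_assoc]
      exact rmul_mono_right x le_top
    have h2 := dedekind x ⊤ f
    rw [inf_eq_right.2 h1, top_inf_eq, conv_eq hx] at h2
    refine h2.trans (rmul_mono_right x ?_)
    have := rmul_mono_left f hx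
    rwa [ident_rmul] at this

theorem conv_rect {x : A} (hx : x ≤ RelOps.ident) : (rect x x)˘ = rect x x := by
  rw [rect, conv_rmul, conv_rmul, conv_top, conv_eq hx, rmul_assoc]

theorem rmul_of_le' {x : A} (hx : x ≤ RelOps.ident) {f : A} (hf : f ≤ rect x x) : f ⨾ x = f := by
  have h := conv_mono hf
  rw [conv_rect hx] at h
  have h2 := congrArg RelOps.conv (rmul_of_le hx h)
  rwa [conv_rmul, conv_conv, conv_eq hx] at h2

theorem le_rect {x : A} (hx : x ≤ RelOps.ident) : x ≤ rect x x := by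
  refine (le_rmul_self hx).trans (rmul_mono_left x ?_)
  have := rmul_mono_right x (le_top : (RelOps.ident : A) ≤ ⊤)
  rwa [rmul_ident] at this

theorem rect_rmul_rect {x : A} (hx : x ≤ RelOps.ident) {f g : A} (hf : f ≤ rect x x) (hg : g ≤ rect x x) :
    f ⨾ g ≤ rect x x := by
  rw [← rmul_of_le' hx hg, ← rmul_of_le hx hf, rect]
  rw [← rmul_assoc x f, rmul_assoc f, rmul_assoc x]
  exact rmul_mono_left x (rmul_mono_right x le_top)

theorem rect_inf_ident {x : A} (hx : x ≤ RelOps.ident) {t : A} (ht : t ≤ rect x x) (ht' : t ≤ RelOps.ident) : t ≤ x := by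
  rw [← rmul_of_le' hx ht]
  have := rmul_mono_left x ht'
  rwa [ident_rmul] at this

theorem conv_rmul_self_ne_bot {f : A} (hf : f ≠ ⊥) : f˘ ⨾ f ≠ ⊥ := by
  intro h
  have h1 := dedekind f RelOps.ident f
  rw [h, inf_bot_eq, rmul_bot, rmul_ident, inf_idem] at h1
  exact hf (le_bot_iff.1 h1)

theorem conv_ne_bot {f : A} (hf : f ≠ ⊥) : f˘ ≠ ⊥ := by
  intro h
  apply hf
  rw [← conv_conv f, h, conv_bot]

theorem conv_rmul_self {x : A} (hx : IsMeasurableAtom x) {f : A}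
    (h0 : f ≠ ⊥) (h1 : IsFunctional f) (h2 : f ≤ rect x x) :
    f˘ ⨾ f = x := by
  have h3 := conv_mono h2
  rw [conv_rect hx.le_ident] at h3
  have h4 := rect_inf_ident hx.le_ident (rect_rmul_rect hx.le_ident h3 h2) h1
  exact (hx.isAtom.le_iff.1 h4).resolve_left (conv_rmul_self_ne_bot h0)

theorem isFunctional_conv {x : A} (hx : IsMeasurableAtom x) {f : A}
    (h0 : f ≠ ⊥) (h1 : IsFunctional f) (h2 : f ≤ rect x x) :
    IsFunctional f˘ := by
  have hc : f˘ ≤ rect x x := by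
    have := conv_mono h2
    rwa [conv_rect hx.le_ident] at this
  obtain ⟨S, hS, hlub⟩ := hx.square
  -- some function in `S` meets the converse of `f`
  obtain ⟨g, hg, hne⟩ : ∃ g ∈ S, g ⊓ f˘ ≠ ⊥ := by
    by_contra! hcon
    have : rect x x ≤ (f˘)ᶜ := by
      refine hlub.2 fun g hg => ?_
      rw [le_compl_iff_disjoint_right, disjoint_iff]
      exact hcon g hg
    exact conv_ne_bot h0 (le_compl_self.1 (hc.trans this))
  -- `p` is a non-zero part of `f`, hence equal to `f`
  obtain ⟨p, hp⟩ : ∃ p, p = (g ⊓ f˘)˘ := ⟨_, rfl⟩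
  have hpf : p ≤ f := by
    have := conv_mono (inf_le_right : g ⊓ f˘ ≤ f˘)
    rwa [conv_conv, ← hp] at this
  have hp0 : p ≠ ⊥ := hp ▸ conv_ne_bot hne
  have hpr : p ≤ rect x x := hpf.trans h2
  have hpx : p ⨾ (p˘ ⨾ f) ≤ p := by
    have := rmul_mono_right p ((rmul_mono_left f (conv_mono hpf)).trans h1)
    rwa [rmul_ident] at this
  have hpp : x ≤ p ⨾ p˘ := by
    have hcr : p˘ ≤ rect x x := by
      have := conv_mono hpr
      rwa [conv_rect hx.le_ident] at this
    have hd := dedekind (p˘) RelOps.ident (p˘)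
    rw [rmul_ident, inf_idem, conv_conv p] at hd
    have hne' : RelOps.ident ⊓ (p ⨾ p˘) ≠ ⊥ := by
      intro h
      rw [h, rmul_bot] at hd
      exact conv_ne_bot hp0 (le_bot_iff.1 hd)
    have hle : RelOps.ident ⊓ (p ⨾ p˘) ≤ x :=
      rect_inf_ident hx.le_ident
        (inf_le_right.trans (rect_rmul_rect hx.le_ident hpr hcr)) inf_le_left
    have := (hx.isAtom.le_iff.1 hle).resolve_left hne'
    rw [← this]
    exact inf_le_right
  have hfp : f ≤ p := by
    have := rmul_mono_left f hpp
    rw [rmul_of_le hx.le_ident h2, ← rmul_assoc] at this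
    exact this.trans hpx
  have hfg : f˘ ≤ g := by
    have := conv_mono hfp
    rw [hp, conv_conv] at this
    exact this.trans inf_le_left
  exact (rmul_mono (conv_mono hfg) hfg).trans (hS g hg)

end RelAlg

open IsRelationAlgebra RelAlg in
/-- `G_x` is a group under relative multiplication and converse, with identity element `x`. -/
instance PermGroup.instGroup [IsRelationAlgebra A] (x : MAtom A) : Group (PermGroup x) where
  mul f g := ⟨f.1 ⨾ g.1, by
    obtain ⟨f, hf0, hf1, hf2⟩ := f
    obtain ⟨g, hg0, hg1, hg2⟩ := g
    refine ⟨fun h => ?_, ?_, rect_rmul_rect x.2.le_ident hf2 hg2⟩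
    · have h3 : f˘ ⨾ (f ⨾ g) = ⊥ := by rw [h, rmul_bot]
      rw [rmul_assoc, conv_rmul_self x.2 hf0 hf1 hf2, rmul_of_le x.2.le_ident hg2] at h3
      exact hg0 h3
    · change (f ⨾ g)˘ ⨾ (f ⨾ g) ≤ RelOps.ident
      rw [conv_rmul, rmul_assoc, ← rmul_assoc (g˘), conv_rmul_self x.2 hf0 hf1 hf2,
        ← rmul_assoc, rmul_of_le x.2.le_ident hg2]
      exact hg1⟩
  one := ⟨x.1, x.2.isAtom.1, by
    rw [IsFunctional, conv_eq x.2.le_ident]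
    have := rmul_mono x.2.le_ident x.2.le_ident
    rwa [rmul_ident] at this, le_rect x.2.le_ident⟩
  inv f := ⟨f.1˘, conv_ne_bot f.2.1, isFunctional_conv x.2 f.2.1 f.2.2.1 f.2.2.2, by
    have := conv_mono f.2.2.2
    rwa [conv_rect x.2.le_ident] at this⟩
  mul_assoc f g h := Subtype.ext (rmul_assoc f.1 g.1 h.1).symm
  one_mul f := Subtype.ext (rmul_of_le x.2.le_ident f.2.2.2)
  mul_one f := Subtype.ext (rmul_of_le' x.2.le_ident f.2.2.2)
  inv_mul_cancel f := Subtype.ext (conv_rmul_self x.2 f.2.1 f.2.2.1 f.2.2.2)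

variable (A) in
/-- Semi-scaffolds: systems of atoms `a_xy` indexed by the pairs in `ℰ`. -/
structure SemiScaffold where
  a : ∀ {x y : MAtom A}, Linked x y → A
  isAtom : ∀ {x y : MAtom A} (h : Linked x y), IsAtom (a h)
  le_rect : ∀ {x y : MAtom A} (h : Linked x y), a h ≤ rect x.1 y.1
  diag : ∀ {x : MAtom A} (h : Linked x x), a h = x.1
  symm : ∀ {x y : MAtom A} (h : Linked x y) (h' : Linked y x), a h' = (a h)˘

end Measurable

/-! ## Group triples, semi-frames and their algebras -/

/-- A group triple over a system `G` of groups indexed by `I` and a relation `E` on `I`: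
`E` is an equivalence relation, `φ_xy` is an isomorphism from `G_x/H_xy` to `G_y/K_xy` for
every pair in `E`, and `C_xyz` is a coset of the normal subgroup `H_xy H_xz` of `G_x` whenever
`(x,y)` and `(y,z)` are in `E`. (The groups are made disjoint by working in `Σ x, G x`.) -/
structure GroupTriple {I : Type u} (E : I → I → Prop) (G : I → Type v)
    [∀ x, Group (G x)] where
  equiv : Equivalence E
  H : ∀ {x y : I}, E x y → Subgroup (G x)
  K : ∀ {x y : I}, E x y → Subgroup (G y)
  [normal_H : ∀ {x y : I} (h : E x y), (H h).Normal]
  [normal_K : ∀ {x y : I} (h : E x y), (K h).Normal]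
  φ : ∀ {x y : I} (h : E x y), (G x ⧸ H h) ≃* (G y ⧸ K h)
  C : ∀ {x y z : I}, E x y → E y z → Set (G x)
  isCoset_C : ∀ {x y z : I} (hxy : E x y) (hyz : E y z),
    ∃ c : G x, C hxy hyz = c • ((H hxy : Set (G x)) * (H (equiv.trans hxy hyz) : Set (G x)))

namespace GroupTriple

attribute [instance] GroupTriple.normal_H GroupTriple.normal_K

variable {I : Type u} {E : I → I → Prop} {G : I → Type v} [∀ x, Group (G x)]
  (F : GroupTriple E G)

/-- `φ_xy[M]`, the union of the images under `φ_xy` of the cosets of `H_xy` that meet `M`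
(for unions `M` of cosets of `H_xy`: of the cosets contained in `M`). -/
def img {x y : I} (h : E x y) (M : Set (G x)) : Set (G y) :=
  {k | ∃ g ∈ M, F.φ h (g : G x ⧸ F.H h) = (k : G y ⧸ F.K h)}

/-- `φ_xy⁻¹[N]`, the union of the inverse images under `φ_xy` of the cosets of `K_xy` that
meet `N`. -/
def preimg {x y : I} (h : E x y) (N : Set (G y)) : Set (G x) :=
  {g | ∃ k ∈ N, F.φ h (g : G x ⧸ F.H h) = (k : G y ⧸ F.K h)}

/-- The semi-frame conditions. In the last one, `M` runs through the cosets of `H_xy H_xz`: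
the isomorphisms induced by `φ_xy`, `φ_yz`, `φ_xz` send a coset to its image, and the
inner automorphism determined by `C_xyz` sends `M` to `C_xyz⁻¹ M C_xyz`. -/
structure IsSemiFrame : Prop where
  diag : ∀ {x : I} (h : E x x), F.H h = ⊥ ∧ F.K h = ⊥ ∧
    ∀ g : G x, F.φ h (g : G x ⧸ F.H h) = (g : G x ⧸ F.K h)
  symm : ∀ {x y : I} (h : E x y) (h' : E y x), F.H h' = F.K h ∧ F.K h' = F.H h ∧
    ∀ (g : G x) (k : G y), F.φ h' (k : G y ⧸ F.H h') = (g : G x ⧸ F.K h') ↔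
      F.φ h (g : G x ⧸ F.H h) = (k : G y ⧸ F.K h)
  image : ∀ {x y z : I} (hxy : E x y) (hyz : E y z) (hxz : E x z),
    F.img hxy ((F.H hxy : Set (G x)) * (F.H hxz : Set (G x))) =
      (F.K hxy : Set (G y)) * (F.H hyz : Set (G y))
  comp : ∀ {x y z : I} (hxy : E x y) (hyz : E y z) (hxz : E x z) (g : G x) (M : Set (G x)),
    M = g • ((F.H hxy : Set (G x)) * (F.H hxz : Set (G x))) →
    F.img hyz (F.img hxy M) = F.img hxz ((F.C hxy hyz)⁻¹ * M * F.C hxy hyz)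

/-- The atomic relation `R_{xy,α}`, the union of the sets `H_{xy,ξ} × (K_{xy,ξ} K_{xy,α})`
over all `ξ`, where the cosets of `K_xy` are indexed through `K_{xy,ξ} = φ_xy(H_{xy,ξ})` by
those of `H_xy`. -/
def atomRel {x y : I} (h : E x y) (α : G x ⧸ F.H h) : Set ((Σ x, G x) × (Σ x, G x)) :=
  ⋃ ξ : G x ⧸ F.H h, {p | ∃ (g : G x) (k : G y), p = (⟨x, g⟩, ⟨y, k⟩) ∧
    (g : G x ⧸ F.H h) = ξ ∧ (k : G y ⧸ F.K h) = F.φ h ξ * F.φ h α}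

/-- Unions of sets of atomic relations. -/
def IsUnionOfAtoms (R : Set ((Σ x, G x) × (Σ x, G x))) : Prop :=
  ∃ 𝒳 : Set (Set ((Σ x, G x) × (Σ x, G x))),
    (∀ X ∈ 𝒳, ∃ (x y : I) (h : E x y) (α : G x ⧸ F.H h), X = F.atomRel h α) ∧ R = ⋃₀ 𝒳

/-- The unit, the union of all atomic relations. -/
def unit : Set ((Σ x, G x) × (Σ x, G x)) :=
  {p | ∃ (x y : I) (h : E x y) (α : G x ⧸ F.H h), p ∈ F.atomRel h α}

/-- The relation `R_{xy,α} ⊗ R_{yz,β}`, the union of the `R_{xz,γ}` for which `H_{xz,γ}` is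
included in `φ_xy⁻¹[K_{xy,α} H_{yz,β}] C_xyz`. -/
def atomMul {x y z : I} (hxy : E x y) (hyz : E y z) (α : G x ⧸ F.H hxy)
    (β : G y ⧸ F.H hyz) : Set ((Σ x, G x) × (Σ x, G x)) :=
  ⋃ γ ∈ {γ : G x ⧸ F.H (F.equiv.trans hxy hyz) |
    {g : G x | (g : G x ⧸ F.H (F.equiv.trans hxy hyz)) = γ} ⊆
      F.preimg hxy ({k : G y | (k : G y ⧸ F.K hxy) = F.φ hxy α} *
        {k : G y | (k : G y ⧸ F.H hyz) = β}) * F.C hxy hyz},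
    F.atomRel (F.equiv.trans hxy hyz) γ

/-- The completely distributive extension of `⊗` from atomic relations to arbitrary unions;
the products `R_{xy,α} ⊗ R_{wz,β}` with `y ≠ w` are empty. -/
def relMul (R S : Set ((Σ x, G x) × (Σ x, G x))) : Set ((Σ x, G x) × (Σ x, G x)) :=
  {p | ∃ (x y z : I) (hxy : E x y) (hyz : E y z) (α : G x ⧸ F.H hxy) (β : G y ⧸ F.H hyz),
    F.atomRel hxy α ⊆ R ∧ F.atomRel hyz β ⊆ S ∧ p ∈ F.atomMul hxy hyz α β}

section Closure

variable {F}

theorem mem_atomRel {x y : I} {h : E x y} {α : G x ⧸ F.H h} {g : G x} {k : G y} :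
    ((⟨x, g⟩, ⟨y, k⟩) : (Σ x, G x) × (Σ x, G x)) ∈ F.atomRel h α ↔
      (k : G y ⧸ F.K h) = F.φ h g * F.φ h α := by
  simp only [atomRel, Set.mem_iUnion, Set.mem_ofPred_eq]
  constructor
  · rintro ⟨ξ, g', k', hp, rfl, hk⟩
    simp only [Prod.mk.injEq, Sigma.mk.injEq, heq_eq_eq, true_and] at hp
    obtain ⟨rfl, rfl⟩ := hp
    exact hk
  · intro hk
    exact ⟨_, g, k, rfl, rfl, hk⟩

theorem exists_of_mem {x y : I} {h : E x y} {α : G x ⧸ F.H h}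
    {p : (Σ x, G x) × (Σ x, G x)} (hp : p ∈ F.atomRel h α) :
    ∃ (g : G x) (k : G y), p = (⟨x, g⟩, ⟨y, k⟩) := by
  simp only [atomRel, Set.mem_iUnion, Set.mem_ofPred_eq] at hp
  obtain ⟨_, g, k, hp, _⟩ := hp
  exact ⟨g, k, hp⟩

theorem mem_unit {x y : I} {g : G x} {k : G y} (h : E x y) :
    ((⟨x, g⟩, ⟨y, k⟩) : (Σ x, G x) × (Σ x, G x)) ∈ F.unit := by
  refine ⟨x, y, h, (F.φ h).symm ((F.φ h g)⁻¹ * k), ?_⟩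
  rw [mem_atomRel]
  simp

theorem atomRel_eq {x y x' y' : I} {h : E x y} {h' : E x' y'} {α : G x ⧸ F.H h}
    {α' : G x' ⧸ F.H h'} {p : (Σ x, G x) × (Σ x, G x)} (hp : p ∈ F.atomRel h α)
    (hp' : p ∈ F.atomRel h' α') : F.atomRel h α = F.atomRel h' α' := by
  obtain ⟨g, k, rfl⟩ := exists_of_mem hp
  obtain ⟨g', k', he⟩ := exists_of_mem hp'
  simp only [Prod.mk.injEq, Sigma.mk.injEq] at he
  obtain ⟨⟨rfl, _⟩, ⟨rfl, _⟩⟩ := he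
  rw [mem_atomRel] at hp hp'
  rw [hp] at hp'
  have : α = α' := (F.φ h).injective (mul_left_cancel hp')
  rw [this]

theorem isUnionOfAtoms_iff {R : Set ((Σ x, G x) × (Σ x, G x))} :
    F.IsUnionOfAtoms R ↔ R ⊆ F.unit ∧
      ∀ (x y : I) (h : E x y) (α : G x ⧸ F.H h) (p : (Σ x, G x) × (Σ x, G x)),
        p ∈ F.atomRel h α → p ∈ R → F.atomRel h α ⊆ R := by
  constructor
  · rintro ⟨𝒳, h𝒳, rfl⟩
    refine ⟨?_, ?_⟩
    · rintro p ⟨X, hX, hp⟩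
      obtain ⟨x, y, h, α, rfl⟩ := h𝒳 X hX
      exact ⟨x, y, h, α, hp⟩
    · rintro x y h α p hp ⟨X, hX, hpX⟩
      obtain ⟨x', y', h', α', rfl⟩ := h𝒳 X hX
      rw [atomRel_eq hp hpX]
      exact Set.subset_sUnion_of_mem hX
  · rintro ⟨h1, h2⟩
    refine ⟨{X | (∃ (x y : I) (h : E x y) (α : G x ⧸ F.H h), X = F.atomRel h α) ∧ X ⊆ R},
      fun X hX => hX.1, Set.Subset.antisymm (fun p hp => ?_) (Set.sUnion_subset fun X hX => hX.2)⟩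
    obtain ⟨x, y, h, α, hpα⟩ := h1 hp
    exact ⟨_, ⟨⟨x, y, h, α, rfl⟩, h2 x y h α p hpα hp⟩, hpα⟩

theorem isUnionOfAtoms_union {R S : Set ((Σ x, G x) × (Σ x, G x))} (hR : F.IsUnionOfAtoms R)
    (hS : F.IsUnionOfAtoms S) : F.IsUnionOfAtoms (R ∪ S) := by
  rw [isUnionOfAtoms_iff] at *
  refine ⟨Set.union_subset hR.1 hS.1, ?_⟩
  rintro x y h α p hp (h1 | h1)
  · exact (hR.2 x y h α p hp h1).trans Set.subset_union_left
  · exact (hS.2 x y h α p hp h1).trans Set.subset_union_right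

theorem isUnionOfAtoms_inter {R S : Set ((Σ x, G x) × (Σ x, G x))} (hR : F.IsUnionOfAtoms R)
    (hS : F.IsUnionOfAtoms S) : F.IsUnionOfAtoms (R ∩ S) := by
  rw [isUnionOfAtoms_iff] at *
  refine ⟨Set.inter_subset_left.trans hR.1, ?_⟩
  rintro x y h α p hp ⟨h1, h2⟩
  exact Set.subset_inter (hR.2 x y h α p hp h1) (hS.2 x y h α p hp h2)

theorem isUnionOfAtoms_diff {R : Set ((Σ x, G x) × (Σ x, G x))} (hR : F.IsUnionOfAtoms R) :
    F.IsUnionOfAtoms (F.unit \ R) := by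
  rw [isUnionOfAtoms_iff] at *
  refine ⟨Set.sdiff_subset, ?_⟩
  rintro x y h α p hp ⟨_, h1⟩ q hq
  exact ⟨⟨x, y, h, α, hq⟩, fun hqR => h1 (hR.2 x y h α q hq hqR hp)⟩

theorem isUnionOfAtoms_unit : F.IsUnionOfAtoms F.unit := by
  rw [isUnionOfAtoms_iff]
  exact ⟨subset_rfl, fun x y h α p _ _ q hq => ⟨x, y, h, α, hq⟩⟩

theorem isUnionOfAtoms_empty : F.IsUnionOfAtoms ∅ := by
  rw [isUnionOfAtoms_iff]
  exact ⟨Set.empty_subset _, fun x y h α p _ hp => absurd hp (Set.notMem_empty p)⟩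

theorem isUnionOfAtoms_relMul (R S : Set ((Σ x, G x) × (Σ x, G x))) :
    F.IsUnionOfAtoms (F.relMul R S) := by
  refine ⟨{X | (∃ (x y : I) (h : E x y) (α : G x ⧸ F.H h), X = F.atomRel h α) ∧
    X ⊆ F.relMul R S}, fun X hX => hX.1,
    Set.Subset.antisymm (fun p hp => ?_) (Set.sUnion_subset fun X hX => hX.2)⟩
  obtain ⟨x, y, z, hxy, hyz, α, β, hα, hβ, hp⟩ := hp
  simp only [atomMul, Set.mem_iUnion] at hp
  obtain ⟨γ, hγ, hp⟩ := hp
  refine ⟨_, ⟨⟨x, z, _, γ, rfl⟩, fun q hq => ?_⟩, hp⟩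
  refine ⟨x, y, z, hxy, hyz, α, β, hα, hβ, ?_⟩
  simp only [atomMul, Set.mem_iUnion]
  exact ⟨γ, hγ, hq⟩

theorem isUnionOfAtoms_id (hF : F.IsSemiFrame) :
    F.IsUnionOfAtoms {p : (Σ x, G x) × (Σ x, G x) | p.1 = p.2} := by
  rw [isUnionOfAtoms_iff]
  refine ⟨?_, ?_⟩
  · rintro ⟨⟨x, g⟩, q⟩ hq
    obtain rfl : (⟨x, g⟩ : Σ x, G x) = q := hq
    exact mem_unit (F.equiv.refl x)
  · rintro x y h α p hp hid q hq
    obtain ⟨g, k, rfl⟩ := exists_of_mem hp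
    obtain ⟨g', k', rfl⟩ := exists_of_mem hq
    simp only [Set.mem_ofPred_eq, Sigma.mk.injEq] at hid
    obtain ⟨rfl, hid⟩ := hid
    obtain rfl := eq_of_heq hid
    obtain ⟨_, hK, hφ⟩ := hF.diag h
    rw [mem_atomRel, hφ] at hp hq
    have h1 : F.φ h α = 1 := by simpa using hp
    rw [h1, mul_one, QuotientGroup.eq, hK, Subgroup.mem_bot, inv_mul_eq_one] at hq
    simp [hq]

theorem isUnionOfAtoms_swap (hF : F.IsSemiFrame) {R : Set ((Σ x, G x) × (Σ x, G x))}
    (hR : F.IsUnionOfAtoms R) : F.IsUnionOfAtoms (Prod.swap ⁻¹' R) := by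
  rw [isUnionOfAtoms_iff] at *
  refine ⟨?_, ?_⟩
  · rintro ⟨p, q⟩ hp
    obtain ⟨x, y, h, α, hp⟩ := hR.1 hp
    obtain ⟨g, k, he⟩ := exists_of_mem hp
    simp only [Prod.swap_prod_mk, Prod.mk.injEq] at he
    obtain ⟨rfl, rfl⟩ := he
    exact mem_unit (F.equiv.symm h)
  · rintro y x h' β p hp hpR q hq
    obtain ⟨k, g, rfl⟩ := exists_of_mem hp
    obtain ⟨k', g', rfl⟩ := exists_of_mem hq
    have h : E x y := F.equiv.symm h'
    obtain ⟨α, hα⟩ : ∃ α, ((⟨x, g⟩, ⟨y, k⟩) : (Σ x, G x) × (Σ x, G x)) ∈ F.atomRel h α :=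
      ⟨(F.φ h).symm ((F.φ h g)⁻¹ * k), by rw [mem_atomRel]; simp⟩
    refine hR.2 x y h α _ hα hpR ?_
    obtain ⟨b, rfl⟩ := QuotientGroup.mk_surjective β
    have key : ∀ (c : G x) (d : G y),
        ((⟨y, d⟩, ⟨x, c⟩) : (Σ x, G x) × (Σ x, G x)) ∈ F.atomRel h' (b : G y ⧸ F.H h') →
          F.φ h (c : G x ⧸ F.H h) = (d : G y ⧸ F.K h) * (b : G y ⧸ F.K h) := by
      intro c d hcd
      rw [mem_atomRel, ← map_mul, ← QuotientGroup.mk_mul] at hcd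
      rw [← QuotientGroup.mk_mul]
      exact ((hF.symm h h').2.2 c (d * b)).1 hcd.symm
    have h1 := key g k hp
    have h2 := key g' k' hq
    change ((⟨x, g'⟩, ⟨y, k'⟩) : (Σ x, G x) × (Σ x, G x)) ∈ F.atomRel h α
    rw [mem_atomRel] at hα ⊢
    rw [h1, mul_assoc, left_eq_mul] at hα
    rw [h2, mul_assoc, hα, mul_one]

end Closure

end GroupTriple

/-- The universe of the algebra of a semi-frame: all unions of sets of atomic relations. -/
def CosetAlgebra {I : Type u} {E : I → I → Prop} {G : I → Type v} [∀ x, Group (G x)]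
    (F : GroupTriple E G) (_hF : F.IsSemiFrame) : Type (max u v) :=
  {R : Set ((Σ x, G x) × (Σ x, G x)) // F.IsUnionOfAtoms R}

namespace CosetAlgebra

open GroupTriple

variable {I : Type u} {E : I → I → Prop} {G : I → Type v} [∀ x, Group (G x)]
  {F : GroupTriple E G} {hF : F.IsSemiFrame}

/-- The Boolean operations are the set-theoretic ones, complements being taken in the unit. -/
instance instBooleanAlgebra : BooleanAlgebra (CosetAlgebra F hF) where
  le R S := R.1 ⊆ S.1
  le_refl R := subset_rfl
  le_trans R S T h h' := h.trans h'
  le_antisymm R S h h' := Subtype.ext (Set.Subset.antisymm h h')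
  sup R S := ⟨R.1 ∪ S.1, isUnionOfAtoms_union R.2 S.2⟩
  le_sup_left R S := Set.subset_union_left
  le_sup_right R S := Set.subset_union_right
  sup_le R S T h h' := Set.union_subset h h'
  inf R S := ⟨R.1 ∩ S.1, isUnionOfAtoms_inter R.2 S.2⟩
  inf_le_left R S := Set.inter_subset_left
  inf_le_right R S := Set.inter_subset_right
  le_inf R S T h h' := Set.subset_inter h h'
  le_sup_inf R S T := (Set.union_inter_distrib_left R.1 S.1 T.1).ge
  compl R := ⟨F.unit \ R.1, isUnionOfAtoms_diff R.2⟩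
  top := ⟨F.unit, isUnionOfAtoms_unit⟩
  bot := ⟨∅, isUnionOfAtoms_empty⟩
  inf_compl_le_bot R := fun _ hp => hp.2.2 hp.1
  top_le_sup_compl R := fun p hp => by
    by_cases h : p ∈ R.1
    · exact Or.inl h
    · exact Or.inr ⟨hp, h⟩
  le_top R := (isUnionOfAtoms_iff.1 R.2).1
  bot_le R := Set.empty_subset _

/-- The operation `⊗`, the converse of relations, and the identity relation on `⋃ G_x`. -/
instance instRelOps : RelOps (CosetAlgebra F hF) where
  rmul R S := ⟨F.relMul R.1 S.1, isUnionOfAtoms_relMul R.1 S.1⟩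
  conv R := ⟨Prod.swap ⁻¹' R.1, isUnionOfAtoms_swap hF R.2⟩
  ident := ⟨{p | p.1 = p.2}, isUnionOfAtoms_id hF⟩

end CosetAlgebra

/-! ## The group triple associated with a semi-scaffold -/

/-- `F` is the group triple associated with the semi-scaffold `a`: its groups are the `G_x`
indexed by the measurable atoms, its relation is `ℰ`, `H_xy` and `K_xy` are the left and right
stabilizers of `a_xy`, the isomorphism `φ_xy` is determined by the equation `f;a_xy = a_xy;g`,
and `C_xyz = H_xy;H_{xz,ζ}` for a coset `H_{xz,ζ} = f;H_xz` with
`H_{xz,ζ};a_xz = f;a_xz ≤ a_xy;a_yz`. -/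
structure IsAssociated {A : Type u} [BooleanAlgebra A] [RelOps A] [IsRelationAlgebra A]
    (s : SemiScaffold A)
    (F : GroupTriple (Linked (A := A)) (fun x : MAtom A => PermGroup x)) : Prop where
  mem_H : ∀ {x y : MAtom A} (h : Linked x y) (f : PermGroup x),
    f ∈ F.H h ↔ f.1 ⨾ s.a h = s.a h
  mem_K : ∀ {x y : MAtom A} (h : Linked x y) (g : PermGroup y),
    g ∈ F.K h ↔ s.a h ⨾ g.1 = s.a h
  φ_iff : ∀ {x y : MAtom A} (h : Linked x y) (f : PermGroup x) (g : PermGroup y),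
    F.φ h (f : PermGroup x ⧸ F.H h) = (g : PermGroup y ⧸ F.K h) ↔
      f.1 ⨾ s.a h = s.a h ⨾ g.1
  C_eq : ∀ {x y z : MAtom A} (hxy : Linked x y) (hyz : Linked y z) (hxz : Linked x z),
    ∃ f : PermGroup x, f.1 ⨾ s.a hxz ≤ s.a hxy ⨾ s.a hyz ∧
      F.C hxy hyz = (F.H hxy : Set (PermGroup x)) * (f • (F.H hxz : Set (PermGroup x)))

/-! ## Arithmetic of relation algebras -/

namespace RelAlg

open IsRelationAlgebra

section Basic

variable {A : Type u} [BooleanAlgebra A]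

/-! The sets of atoms of an atomic relation algebra, with operations read off from atoms, form a
completion. Conversely, density makes every completion inherit atoms and existing suprema, hence
atomicity and measurability. The rest takes place in a complete, atomic, measurable `A`.

The heart is that `G_x` acts transitively, by left multiplication, on the atoms below a rectangle
`x;1;y` (`exists_perm_rmul_eq`): the square `x;1;x` is a sum of functions and multiplication is
completely additive, so for atoms `a`, `b` some function `f` makes `f;a` meet `b`, and `f;a` is an
atom because `f` is invertible. The same holds for `G_y` on the right, and the two actions commute.
So the stabilizers of `a_xy` are normal, `f;a_xy = a_xy;g` defines an isomorphism of quotients, and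
every atom below `x;1;y` corresponds to one coset of `H_xy`.

A product `a_xy;a_yz` is determined by the elements `f` with `f;a_xz` below it; they form `C_xyz`,
since two such atoms differ by an element of `H_xy` (`mem_C`). The semi-frame conditions and the
formula for `⊗` (`subset_preimg_mul_C_iff`) then follow by calculation with atoms.

The isomorphism is of Cayley type: `r` goes to the set of pairs `(g, k)` with `g˘;a_xy;k ≤ r`. It is
injective by atomicity and surjective by completeness. The axioms for the coset algebra are not
checked but transported along this surjective homomorphism. -/

theorem le_of_isAtom_of_inf_ne_bot {c r : A} (hc : IsAtom c) (h : c ⊓ r ≠ ⊥) : c ≤ r :=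
  inf_eq_left.1 ((hc.le_iff.1 inf_le_left).resolve_left h)

theorem inf_ne_bot_of_isAtom_of_le {c r : A} (hc : IsAtom c) (h : c ≤ r) : c ⊓ r ≠ ⊥ := by
  rw [inf_eq_left.2 h]; exact hc.1

theorem eq_of_isAtom_of_le {b c : A} (hb : IsAtom b) (hc : IsAtom c) (h : b ≤ c) : b = c :=
  (hc.le_iff.1 h).resolve_left hb.1

theorem le_of_forall_isAtom_le [IsAtomic A] {r s : A} (h : ∀ c, IsAtom c → c ≤ r → c ≤ s) :
    r ≤ s := by
  by_contra hcon
  have h1 : r ⊓ sᶜ ≠ ⊥ := fun h => hcon (by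
    rwa [← disjoint_iff, disjoint_compl_right_iff] at h)
  obtain ⟨c, hc, hle⟩ := (eq_bot_or_exists_atom_le _).resolve_left h1
  refine hc.1 (le_bot_iff.1 ?_)
  rw [← inf_compl_self s]
  exact le_inf (h c hc (hle.trans inf_le_left)) (hle.trans inf_le_right)

/-- An element that meets a least upper bound of `S` meets some member of `S`. -/
theorem exists_inf_ne_bot_of_isLUB {S : Set A} {t c : A} (hS : IsLUB S t) (h : t ⊓ c ≠ ⊥) :
    ∃ s ∈ S, s ⊓ c ≠ ⊥ := by
  by_contra! hcon
  have : t ≤ cᶜ := hS.2 fun s hs => by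
    rw [le_compl_iff_disjoint_right, disjoint_iff]
    exact hcon s hs
  rw [le_compl_iff_disjoint_right, disjoint_iff] at this
  exact h this

variable [RelOps A] [IsRelationAlgebra A]

theorem bot_rmul (a : A) : ⊥ ⨾ a = ⊥ := by
  rw [← conv_conv (⊥ ⨾ a), conv_rmul, conv_bot, rmul_bot, conv_bot]

theorem conv_le_iff {a b : A} : a˘ ≤ b ↔ a ≤ b˘ :=
  ⟨fun h => by simpa only [conv_conv] using conv_mono h,
    fun h => by simpa only [conv_conv] using conv_mono h⟩

theorem conv_inf (a b : A) : (a ⊓ b)˘ = a˘ ⊓ b˘ := by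
  apply le_antisymm
  · exact le_inf (conv_mono inf_le_left) (conv_mono inf_le_right)
  · rw [← conv_le_iff]
    refine le_inf ?_ ?_
    · rw [conv_le_iff]; exact inf_le_left
    · rw [conv_le_iff]; exact inf_le_right

theorem isAtom_conv {a : A} (ha : IsAtom a) : IsAtom a˘ := by
  refine ⟨conv_ne_bot ha.1, fun b hb => ?_⟩
  have h1 : b˘ < a := by
    refine lt_of_le_of_ne (conv_le_iff.2 hb.le) fun h => hb.ne ?_
    rw [← h, conv_conv]
  rw [← conv_conv b, ha.2 _ h1, conv_bot]

theorem conv_rmul_inf_ne_bot {a b c : A} (h : (a ⨾ b) ⊓ c ≠ ⊥) : (a˘ ⨾ c) ⊓ b ≠ ⊥ :=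
  fun h' => h (by simpa only [conv_conv] using cycle h')

theorem rmul_conv_inf_ne_bot {a b c : A} (h : (a ⨾ b) ⊓ c ≠ ⊥) : (c ⨾ b˘) ⊓ a ≠ ⊥ := by
  have h1 : (b˘ ⨾ a˘) ⊓ c˘ ≠ ⊥ := by
    rw [← conv_rmul, ← conv_inf]; exact conv_ne_bot h
  have h2 := conv_ne_bot (conv_rmul_inf_ne_bot h1)
  simpa only [conv_inf, conv_rmul, conv_conv] using h2

/-- The cycle law for atoms, where meeting and lying below coincide. Together with
`le_rmul_conv_of_isAtom` it lets a triangle `c ≤ a;b` be solved for either factor. -/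
theorem le_conv_rmul_of_isAtom {a b c : A} (hb : IsAtom b) (hc : IsAtom c) (h : c ≤ a ⨾ b) :
    b ≤ a˘ ⨾ c := by
  refine le_of_isAtom_of_inf_ne_bot hb ?_
  rw [inf_comm]
  refine conv_rmul_inf_ne_bot ?_
  rw [inf_comm]
  exact inf_ne_bot_of_isAtom_of_le hc h

theorem le_rmul_conv_of_isAtom {a b c : A} (ha : IsAtom a) (hc : IsAtom c) (h : c ≤ a ⨾ b) :
    a ≤ c ⨾ b˘ := by
  refine le_of_isAtom_of_inf_ne_bot ha ?_
  rw [inf_comm]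
  refine rmul_conv_inf_ne_bot ?_
  rw [inf_comm]
  exact inf_ne_bot_of_isAtom_of_le hc h

/-- Relative multiplication by a fixed element is completely additive. -/
theorem exists_rmul_inf_ne_bot_of_isLUB {S : Set A} {t r c : A} (hS : IsLUB S t)
    (h : (t ⨾ r) ⊓ c ≠ ⊥) : ∃ s ∈ S, (s ⨾ r) ⊓ c ≠ ⊥ := by
  -- Cycling isolates `t` on one side of a meet, so only the Boolean distributivity of suprema is
  -- needed.
  have h1 := rmul_conv_inf_ne_bot h
  rw [inf_comm] at h1
  obtain ⟨s, hs, h2⟩ := exists_inf_ne_bot_of_isLUB hS h1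
  refine ⟨s, hs, ?_⟩
  rw [inf_comm] at h2
  have := rmul_conv_inf_ne_bot h2
  rwa [conv_conv] at this

/-- Any atom of `(c;s˘) ⊓ r` works, by cycling back. In an atomic algebra this replaces complete
additivity: products are determined by products of atoms. -/
theorem exists_isAtom_le_left [IsAtomic A] {c r s : A} (hc : IsAtom c) (h : c ≤ r ⨾ s) :
    ∃ a, IsAtom a ∧ a ≤ r ∧ c ≤ a ⨾ s := by
  have h1 : (r ⨾ s) ⊓ c ≠ ⊥ := by rw [inf_comm]; exact inf_ne_bot_of_isAtom_of_le hc h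
  obtain ⟨a, ha, hle⟩ := (eq_bot_or_exists_atom_le _).resolve_left (rmul_conv_inf_ne_bot h1)
  refine ⟨a, ha, hle.trans inf_le_right, ?_⟩
  have := le_rmul_conv_of_isAtom hc ha (hle.trans inf_le_left)
  rwa [conv_conv] at this

theorem exists_isAtom_le_right [IsAtomic A] {c r s : A} (hc : IsAtom c) (h : c ≤ r ⨾ s) :
    ∃ b, IsAtom b ∧ b ≤ s ∧ c ≤ r ⨾ b := by
  have h1 : (r ⨾ s) ⊓ c ≠ ⊥ := by rw [inf_comm]; exact inf_ne_bot_of_isAtom_of_le hc h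
  obtain ⟨b, hb, hle⟩ := (eq_bot_or_exists_atom_le _).resolve_left (conv_rmul_inf_ne_bot h1)
  refine ⟨b, hb, hle.trans inf_le_right, ?_⟩
  have := le_conv_rmul_of_isAtom hc hb (hle.trans inf_le_left)
  rwa [conv_conv] at this

theorem exists_isAtom_le_rmul [IsAtomic A] {c r s : A} (hc : IsAtom c) (h : c ≤ r ⨾ s) :
    ∃ a b, IsAtom a ∧ IsAtom b ∧ a ≤ r ∧ b ≤ s ∧ c ≤ a ⨾ b := by
  obtain ⟨a, ha, har, h1⟩ := exists_isAtom_le_left hc h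
  obtain ⟨b, hb, hbs, h2⟩ := exists_isAtom_le_right hc h1
  exact ⟨a, b, ha, hb, har, hbs, h2⟩

end Basic

end RelAlg

/-- All axioms, Tarski's law included, are equations, so they pass to homomorphic images. This
spares a direct proof that `⊗` is associative. -/
theorem IsRAHom.isRelationAlgebra_of_surjective {A : Type u} {B : Type v} [BooleanAlgebra A]
    [RelOps A] [IsRelationAlgebra A] [BooleanAlgebra B] [RelOps B] {e : A → B} (he : IsRAHom e)
    (hs : Function.Surjective e) : IsRelationAlgebra B where
  rmul_assoc r s t := by
    obtain ⟨r, rfl⟩ := hs r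
    obtain ⟨s, rfl⟩ := hs s
    obtain ⟨t, rfl⟩ := hs t
    simp only [← he.map_rmul, IsRelationAlgebra.rmul_assoc]
  rmul_ident r := by
    obtain ⟨r, rfl⟩ := hs r
    rw [← he.map_ident, ← he.map_rmul, IsRelationAlgebra.rmul_ident]
  conv_conv r := by
    obtain ⟨r, rfl⟩ := hs r
    rw [← he.map_conv, ← he.map_conv, IsRelationAlgebra.conv_conv]
  conv_rmul r s := by
    obtain ⟨r, rfl⟩ := hs r
    obtain ⟨s, rfl⟩ := hs s
    rw [← he.map_rmul, ← he.map_conv, IsRelationAlgebra.conv_rmul, he.map_rmul, he.map_conv,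
      he.map_conv]
  sup_rmul r s t := by
    obtain ⟨r, rfl⟩ := hs r
    obtain ⟨s, rfl⟩ := hs s
    obtain ⟨t, rfl⟩ := hs t
    simp only [← he.map_rmul, ← he.map_sup, IsRelationAlgebra.sup_rmul]
  conv_sup r s := by
    obtain ⟨r, rfl⟩ := hs r
    obtain ⟨s, rfl⟩ := hs s
    simp only [← he.map_conv, ← he.map_sup, IsRelationAlgebra.conv_sup]
  tarski r s := by
    obtain ⟨r, rfl⟩ := hs r
    obtain ⟨s, rfl⟩ := hs s
    simp only [← he.map_conv, ← he.map_rmul, ← he.map_compl, ← he.map_sup,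
      IsRelationAlgebra.tarski]

/-! ## The completion of an atomic relation algebra -/

/-- The complex algebra of the atom structure: sets of atoms. -/
abbrev AtomSet (B : Type u) [BooleanAlgebra B] : Type u := Set {b : B // IsAtom b}

namespace AtomSet

open RelAlg

variable {B : Type u} [BooleanAlgebra B]

/-- The set of atoms below an element. -/
def below (b : B) : AtomSet B := {c | c.1 ≤ b}

theorem mem_below {b : B} {c : {b : B // IsAtom b}} : c ∈ below b ↔ c.1 ≤ b := Iff.rfl

variable [RelOps B]

instance instRelOps : RelOps (AtomSet B) where
  rmul R S := {c | ∃ a ∈ R, ∃ b ∈ S, c.1 ≤ a.1 ⨾ b.1}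
  conv R := {c | ∃ a ∈ R, c.1 = a.1˘}
  ident := {c | c.1 ≤ RelOps.ident}

theorem mem_rmul {R S : AtomSet B} {c : {b : B // IsAtom b}} :
    c ∈ R ⨾ S ↔ ∃ a ∈ R, ∃ b ∈ S, c.1 ≤ a.1 ⨾ b.1 := Iff.rfl

theorem mem_ident {c : {b : B // IsAtom b}} :
    c ∈ (RelOps.ident : AtomSet B) ↔ c.1 ≤ RelOps.ident := Iff.rfl

variable [IsRelationAlgebra B]

theorem mem_conv {R : AtomSet B} {c : {b : B // IsAtom b}} :
    c ∈ R˘ ↔ (⟨c.1˘, isAtom_conv c.2⟩ : {b : B // IsAtom b}) ∈ R := by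
  constructor
  · rintro ⟨a, ha, hc⟩
    convert ha
    rw [hc, IsRelationAlgebra.conv_conv]
  · intro h
    exact ⟨_, h, (IsRelationAlgebra.conv_conv _).symm⟩

/-- Each axiom becomes a statement about triangles of atoms. Associativity needs an intermediate
atom, which atomicity supplies; Tarski's law is the cycle law. -/
theorem isRelationAlgebra [IsAtomic B] : IsRelationAlgebra (AtomSet B) where
  rmul_assoc R S T := by
    ext d
    simp only [mem_rmul]
    constructor
    · rintro ⟨a, ha, u, ⟨b, hb, c, hc, hu⟩, hd⟩
      have h1 := hd.trans (rmul_mono_right a.1 hu)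
      rw [IsRelationAlgebra.rmul_assoc] at h1
      obtain ⟨w, hw, hle, h2⟩ := exists_isAtom_le_left d.2 h1
      exact ⟨⟨w, hw⟩, ⟨a, ha, b, hb, hle⟩, c, hc, h2⟩
    · rintro ⟨u, ⟨a, ha, b, hb, hu⟩, c, hc, hd⟩
      have h1 := hd.trans (rmul_mono_left c.1 hu)
      rw [← IsRelationAlgebra.rmul_assoc] at h1
      obtain ⟨w, hw, hle, h2⟩ := exists_isAtom_le_right d.2 h1
      exact ⟨a, ha, ⟨w, hw⟩, ⟨b, hb, c, hc, hle⟩, h2⟩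
  rmul_ident R := by
    ext c
    simp only [mem_rmul, mem_ident]
    constructor
    · rintro ⟨a, ha, b, hb, hc⟩
      have h1 := hc.trans (rmul_mono_right a.1 hb)
      rw [IsRelationAlgebra.rmul_ident] at h1
      rwa [Subtype.ext (eq_of_isAtom_of_le c.2 a.2 h1)]
    · intro hc
      obtain ⟨b, hb, hle, h1⟩ := exists_isAtom_le_right c.2
        (IsRelationAlgebra.rmul_ident c.1).ge
      exact ⟨c, hc, ⟨b, hb⟩, hle, h1⟩
  conv_conv R := by
    ext c
    simp only [mem_conv, IsRelationAlgebra.conv_conv]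
  conv_rmul R S := by
    ext c
    simp only [mem_conv, mem_rmul]
    constructor
    · rintro ⟨a, ha, b, hb, hc⟩
      refine ⟨⟨b.1˘, isAtom_conv b.2⟩, ?_, ⟨a.1˘, isAtom_conv a.2⟩, ?_, ?_⟩
      · simpa only [IsRelationAlgebra.conv_conv] using hb
      · simpa only [IsRelationAlgebra.conv_conv] using ha
      · rw [conv_le_iff, IsRelationAlgebra.conv_rmul] at hc
        exact hc
    · rintro ⟨b, hb, a, ha, hc⟩
      refine ⟨_, ha, _, hb, ?_⟩
      rw [conv_le_iff, IsRelationAlgebra.conv_rmul]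
      simpa only [IsRelationAlgebra.conv_conv] using hc
  sup_rmul R S T := by
    ext c
    simp only [mem_rmul, Set.sup_eq_union, Set.mem_union]
    constructor
    · rintro ⟨a, ha | ha, h⟩
      · exact Or.inl ⟨a, ha, h⟩
      · exact Or.inr ⟨a, ha, h⟩
    · rintro (⟨a, ha, h⟩ | ⟨a, ha, h⟩)
      · exact ⟨a, Or.inl ha, h⟩
      · exact ⟨a, Or.inr ha, h⟩
  conv_sup R S := by
    ext c
    simp only [mem_conv, Set.sup_eq_union, Set.mem_union]
  tarski R S := by
    rw [sup_eq_right]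
    intro c hc hcS
    obtain ⟨a, ha, b, hb, hle⟩ := hc
    rw [mem_conv] at ha
    refine hb ⟨_, ha, c, hcS, ?_⟩
    exact le_conv_rmul_of_isAtom b.2 c.2 hle

theorem isCompletion_below [IsAtomic B] : IsCompletion (below (B := B)) where
  relationAlgebra := isRelationAlgebra
  complete S := ⟨sSup S, isLUB_sSup S⟩
  hom :=
    { map_sup := fun r s => by
        ext c
        simp only [mem_below, Set.sup_eq_union, Set.mem_union]
        refine ⟨fun h => ?_, fun h => h.elim (fun h => h.trans le_sup_left)
          fun h => h.trans le_sup_right⟩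
        by_contra! hcon
        have h1 : Disjoint c.1 r := c.2.not_le_iff_disjoint.1 hcon.1
        have h2 : Disjoint c.1 s := c.2.not_le_iff_disjoint.1 hcon.2
        exact c.2.1 (le_bot_iff.1 ((h1.sup_right h2) le_rfl h))
      map_compl := fun r => by
        ext c
        rw [Set.mem_compl_iff, mem_below, mem_below, le_compl_iff_disjoint_right,
          c.2.not_le_iff_disjoint]
      map_rmul := fun r s => by
        ext c
        rw [mem_below, mem_rmul]
        constructor
        · intro h
          obtain ⟨a, b, ha, hb, har, hbs, h1⟩ := exists_isAtom_le_rmul c.2 h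
          exact ⟨⟨a, ha⟩, har, ⟨b, hb⟩, hbs, h1⟩
        · rintro ⟨a, ha, b, hb, h⟩
          exact h.trans (rmul_mono ha hb)
      map_conv := fun r => by
        ext c
        rw [mem_conv, mem_below, mem_below, conv_le_iff]
      map_ident := rfl }
  injective r s h := le_antisymm
    (le_of_forall_isAtom_le fun c hc hr => (Set.ext_iff.1 h ⟨c, hc⟩).1 hr)
    (le_of_forall_isAtom_le fun c hc hr => (Set.ext_iff.1 h ⟨c, hc⟩).2 hr)
  -- For an atom `c` in `R`, the only atom below `c` is `c` itself, so `below c` is a singleton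
  -- inside `R`.
  dense R hR := by
    obtain ⟨c, hc⟩ := Set.nonempty_iff_ne_empty.2 hR
    refine ⟨c.1, c.2.1, fun d hd => ?_⟩
    rwa [Subtype.ext (eq_of_isAtom_of_le d.2 c.2 hd)]

end AtomSet

/-! ## Properties inherited by completions -/

namespace IsRAHom

open RelAlg

variable {B : Type u} {A : Type v} [BooleanAlgebra B] [RelOps B] [BooleanAlgebra A] [RelOps A]
  {e : B → A}

theorem map_inf (he : IsRAHom e) (r s : B) : e (r ⊓ s) = e r ⊓ e s := by
  rw [← compl_compl (r ⊓ s), compl_inf, he.map_compl, he.map_sup, he.map_compl, he.map_compl,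
    compl_sup, compl_compl, compl_compl]

theorem map_top (he : IsRAHom e) : e ⊤ = ⊤ := by
  rw [← sup_compl_eq_top (x := (⊥ : B)), he.map_sup, he.map_compl, sup_compl_eq_top]

theorem map_bot (he : IsRAHom e) : e ⊥ = ⊥ := by
  rw [← compl_top, he.map_compl, he.map_top, compl_top]

theorem monotone (he : IsRAHom e) : Monotone e := fun r s h => by
  rw [← sup_eq_right] at h ⊢
  rw [← he.map_sup, h]

theorem map_rect (he : IsRAHom e) (x y : B) : e (rect x y) = rect (e x) (e y) := by
  rw [rect, rect, he.map_rmul, he.map_rmul, he.map_top]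

theorem isFunctional_map (he : IsRAHom e) {f : B} (hf : IsFunctional f) :
    IsFunctional (e f) := by
  rw [IsFunctional, ← he.map_conv, ← he.map_rmul, ← he.map_ident]
  exact he.monotone hf

end IsRAHom

namespace IsCompletion

open RelAlg

variable {B : Type u} {A : Type v} [BooleanAlgebra B] [RelOps B] [BooleanAlgebra A] [RelOps A]
  {e : B → A}

theorem le_of_map_le (he : IsCompletion e) {r s : B} (h : e r ≤ e s) : r ≤ s := by
  rw [← sup_eq_right] at h ⊢
  rw [← he.hom.map_sup] at h
  exact he.injective h

theorem isAtom_map (he : IsCompletion e) {b : B} (hb : IsAtom b) : IsAtom (e b) := by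
  refine ⟨fun h => hb.1 (he.injective (h.trans he.hom.map_bot.symm)), fun a ha => ?_⟩
  by_contra h0
  obtain ⟨c, hc, hca⟩ := he.dense a h0
  have h1 := (hb.le_iff.1 (he.le_of_map_le (hca.trans ha.le))).resolve_left hc
  subst h1
  exact ha.not_ge hca

theorem isAtomic (he : IsCompletion e) [IsAtomic B] : IsAtomic A where
  eq_bot_or_exists_atom_le a := by
    refine or_iff_not_imp_left.2 fun h0 => ?_
    obtain ⟨b, hb, hba⟩ := he.dense a h0
    obtain ⟨c, hc, hcb⟩ := (eq_bot_or_exists_atom_le b).resolve_left hb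
    exact ⟨e c, he.isAtom_map hc, (he.hom.monotone hcb).trans hba⟩

/-- Density makes `e` preserve existing suprema: a part of `e t` outside an upper bound `u` would
contain some `e b` with `b ≠ ⊥` and `b ≤ t`, yet `b` meets a member of `S`. Hence measurability
transfers. -/
theorem isLUB_image (he : IsCompletion e) {S : Set B} {t : B} (hS : IsLUB S t) :
    IsLUB (e '' S) (e t) := by
  refine ⟨?_, fun u hu => ?_⟩
  · rintro _ ⟨s, hs, rfl⟩
    exact he.hom.monotone (hS.1 hs)
  · by_contra hcon
    have h1 : e t ⊓ uᶜ ≠ ⊥ := fun h => hcon (by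
      rw [← disjoint_iff, disjoint_compl_right_iff] at h; exact h)
    obtain ⟨b, hb, hle⟩ := he.dense _ h1
    have hbt : b ≤ t := he.le_of_map_le (hle.trans inf_le_left)
    have h2 : t ⊓ b ≠ ⊥ := by rwa [inf_eq_right.2 hbt]
    obtain ⟨s, hs, hsb⟩ := exists_inf_ne_bot_of_isLUB hS h2
    apply hsb
    apply he.injective
    rw [he.hom.map_inf, he.hom.map_bot, ← le_bot_iff, ← inf_compl_self u]
    exact inf_le_inf (hu ⟨s, hs, rfl⟩) (hle.trans inf_le_right)

theorem isMeasurableAtom_map (he : IsCompletion e) {x : B} (hx : IsMeasurableAtom x) :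
    IsMeasurableAtom (e x) where
  isAtom := he.isAtom_map hx.isAtom
  le_ident := by
    rw [← he.hom.map_ident]
    exact he.hom.monotone hx.le_ident
  square := by
    obtain ⟨S, hS, hlub⟩ := hx.square
    refine ⟨e '' S, ?_, ?_⟩
    · rintro _ ⟨f, hf, rfl⟩
      exact he.hom.isFunctional_map (hS f hf)
    · rw [← he.hom.map_rect]
      exact he.isLUB_image hlub

theorem isMeasurableAlgebra (he : IsCompletion e) (hB : IsMeasurableAlgebra B) :
    IsMeasurableAlgebra A := by
  obtain ⟨S, hS, hlub⟩ := hB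
  refine ⟨e '' S, ?_, ?_⟩
  · rintro _ ⟨x, hx, rfl⟩
    exact he.isMeasurableAtom_map (hS x hx)
  · rw [← he.hom.map_ident]
    exact he.isLUB_image hlub

end IsCompletion

/-! ## Rectangles and the groups of measurable atoms -/

namespace RelAlg

open IsRelationAlgebra

section Rect

variable {A : Type u} [BooleanAlgebra A] [RelOps A]

theorem linked_of_le {x y : MAtom A} {f : A} (hf : f ≠ ⊥) (h : f ≤ rect x.1 y.1) : Linked x y :=
  fun h0 => hf (le_bot_iff.1 (h.trans h0.le))

variable [IsRelationAlgebra A]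

theorem conv_rect_of_le {x y : A} (hx : x ≤ RelOps.ident) (hy : y ≤ RelOps.ident) :
    (rect x y)˘ = rect y x := by
  rw [rect, rect, conv_rmul, conv_rmul, conv_top, conv_eq hx, conv_eq hy, rmul_assoc]

theorem conv_le_rect {x y f : A} (hx : x ≤ RelOps.ident) (hy : y ≤ RelOps.ident)
    (hf : f ≤ rect x y) : f˘ ≤ rect y x := by
  rw [← conv_rect_of_le hx hy]; exact conv_mono hf

theorem rmul_of_le_rect_left {x y f : A} (hx : x ≤ RelOps.ident) (hf : f ≤ rect x y) :
    x ⨾ f = f := by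
  apply le_antisymm
  · have := rmul_mono_left f hx
    rwa [ident_rmul] at this
  · have h1 : f ≤ x ⨾ ⊤ := by
      refine hf.trans ?_
      rw [rect, ← rmul_assoc]
      exact rmul_mono_right x le_top
    have h2 := dedekind x ⊤ f
    rw [inf_eq_right.2 h1, top_inf_eq, conv_eq hx] at h2
    refine h2.trans (rmul_mono_right x ?_)
    have := rmul_mono_left f hx
    rwa [ident_rmul] at this

theorem rmul_of_le_rect_right {x y f : A} (hx : x ≤ RelOps.ident) (hy : y ≤ RelOps.ident)
    (hf : f ≤ rect x y) : f ⨾ y = f := by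
  have h := congrArg RelOps.conv (rmul_of_le_rect_left hy (conv_le_rect hx hy hf))
  rwa [conv_rmul, conv_conv, conv_eq hy] at h

theorem rmul_rmul_le_rect (x f y : A) : x ⨾ f ⨾ y ≤ rect x y :=
  rmul_mono_left y (rmul_mono_right x le_top)

theorem rmul_le_rect {x y z w f g : A} (hx : x ≤ RelOps.ident) (hy : y ≤ RelOps.ident)
    (hz : z ≤ RelOps.ident) (hf : f ≤ rect x w) (hg : g ≤ rect y z) : f ⨾ g ≤ rect x z := by
  rw [← rmul_of_le_rect_left hx hf, ← rmul_of_le_rect_right hy hz hg, rmul_assoc, ← rmul_assoc x]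
  exact rmul_rmul_le_rect _ _ _

theorem eq_of_rmul_ne_bot {x y : A} (hx : IsMeasurableAtom x) (hy : IsMeasurableAtom y)
    (h : x ⨾ y ≠ ⊥) : x = y := by
  have h1 : x ⨾ y ≤ x := by
    have := rmul_mono_right x hy.le_ident
    rwa [rmul_ident] at this
  have h2 : x ⨾ y ≤ y := by
    have := rmul_mono_left y hx.le_ident
    rwa [ident_rmul] at this
  exact ((hx.isAtom.le_iff.1 h1).resolve_left h).symm.trans
    ((hy.isAtom.le_iff.1 h2).resolve_left h)

/-- Inserting the sides gives `f;g = f;y;w;g`, and distinct measurable atoms have product zero. This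
matches the convention that `⊗` vanishes when the middle indices differ. -/
theorem eq_of_rect_rmul_rect_ne_bot {x y w z : MAtom A} {f g : A} (hf : f ≤ rect x.1 y.1)
    (hg : g ≤ rect w.1 z.1) (h : f ⨾ g ≠ ⊥) : y = w := by
  refine Subtype.ext (eq_of_rmul_ne_bot y.2 w.2 fun h0 => h ?_)
  rw [← rmul_of_le_rect_right x.2.le_ident y.2.le_ident hf,
    ← rmul_of_le_rect_left w.2.le_ident hg, rmul_assoc, ← rmul_assoc f, h0, rmul_bot, bot_rmul]

theorem left_eq_of_le_rect {x y w z : MAtom A} {f : A} (hf : f ≠ ⊥) (h : f ≤ rect x.1 y.1)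
    (h' : f ≤ rect w.1 z.1) : x = w :=
  eq_of_rect_rmul_rect_ne_bot (conv_le_rect x.2.le_ident y.2.le_ident h) h'
    (conv_rmul_self_ne_bot hf)

theorem right_eq_of_le_rect {x y w z : MAtom A} {f : A} (hf : f ≠ ⊥) (h : f ≤ rect x.1 y.1)
    (h' : f ≤ rect w.1 z.1) : y = z :=
  left_eq_of_le_rect (conv_ne_bot hf) (conv_le_rect x.2.le_ident y.2.le_ident h)
    (conv_le_rect w.2.le_ident z.2.le_ident h')

theorem linked_refl (x : MAtom A) : Linked x x :=
  linked_of_le x.2.isAtom.1 (le_rect x.2.le_ident)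

theorem Linked.symm {x y : MAtom A} (h : Linked x y) : Linked y x := by
  rw [Linked, ← conv_rect_of_le x.2.le_ident y.2.le_ident]
  exact conv_ne_bot h

/-- The domain of a non-zero element below a rectangle is the whole side. -/
theorem le_rmul_conv_of_le_rect {x y : MAtom A} {f : A} (hf : f ≠ ⊥) (h : f ≤ rect x.1 y.1) :
    x.1 ≤ f ⨾ f˘ := by
  refine le_of_isAtom_of_inf_ne_bot x.2.isAtom ?_
  rw [inf_comm]
  refine rmul_conv_inf_ne_bot ?_
  rwa [rmul_of_le_rect_left x.2.le_ident h, inf_idem]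

theorem le_conv_rmul_of_le_rect {x y : MAtom A} {f : A} (hf : f ≠ ⊥) (h : f ≤ rect x.1 y.1) :
    y.1 ≤ f˘ ⨾ f := by
  have := le_rmul_conv_of_le_rect (conv_ne_bot hf) (conv_le_rect x.2.le_ident y.2.le_ident h)
  rwa [conv_conv] at this

/-- Since `y ≤ f˘;f`, the factor `g` is recovered from `f;g`. This yields transitivity of `ℰ`. -/
theorem rmul_ne_bot_of_le_rect {x y z : MAtom A} {f g : A} (hf : f ≠ ⊥) (hg : g ≠ ⊥)
    (hfr : f ≤ rect x.1 y.1) (hgr : g ≤ rect y.1 z.1) : f ⨾ g ≠ ⊥ := by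
  intro h
  have h1 := rmul_mono_left g (le_conv_rmul_of_le_rect hf hfr)
  rw [rmul_of_le_rect_left y.2.le_ident hgr, ← rmul_assoc, h, rmul_bot] at h1
  exact hg (le_bot_iff.1 h1)

end Rect

/-! ### The action of the groups on atoms below rectangles -/

section Perm

variable {A : Type u} [BooleanAlgebra A] [RelOps A] [IsRelationAlgebra A]
  {x y z : MAtom A}

theorem perm_val_mul (f g : PermGroup x) : (f * g).1 = f.1 ⨾ g.1 := rfl

theorem perm_val_inv (f : PermGroup x) : (f⁻¹).1 = f.1˘ := rfl

theorem perm_rmul_le_rect (f : PermGroup x) {r : A} (hr : r ≤ rect x.1 y.1) :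
    f.1 ⨾ r ≤ rect x.1 y.1 :=
  rmul_le_rect x.2.le_ident x.2.le_ident y.2.le_ident f.2.2.2 hr

theorem rmul_perm_le_rect (g : PermGroup y) {r : A} (hr : r ≤ rect x.1 y.1) :
    r ⨾ g.1 ≤ rect x.1 y.1 :=
  rmul_le_rect x.2.le_ident y.2.le_ident y.2.le_ident hr g.2.2.2

theorem mul_rmul (f g : PermGroup x) (r : A) : (f * g).1 ⨾ r = f.1 ⨾ (g.1 ⨾ r) :=
  (rmul_assoc _ _ _).symm

theorem one_rmul {r : A} (hr : r ≤ rect x.1 y.1) : (1 : PermGroup x).1 ⨾ r = r :=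
  rmul_of_le_rect_left x.2.le_ident hr

theorem rmul_mul (r : A) (f g : PermGroup y) : r ⨾ (f * g).1 = (r ⨾ f.1) ⨾ g.1 :=
  rmul_assoc _ _ _

theorem rmul_one {r : A} (hr : r ≤ rect x.1 y.1) : r ⨾ (1 : PermGroup y).1 = r :=
  rmul_of_le_rect_right x.2.le_ident y.2.le_ident hr

theorem inv_rmul_cancel (f : PermGroup x) {r : A} (hr : r ≤ rect x.1 y.1) :
    (f⁻¹).1 ⨾ (f.1 ⨾ r) = r := by
  rw [← mul_rmul, inv_mul_cancel, one_rmul hr]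

theorem rmul_inv_cancel (f : PermGroup x) {r : A} (hr : r ≤ rect x.1 y.1) :
    f.1 ⨾ ((f⁻¹).1 ⨾ r) = r := by
  rw [← mul_rmul, mul_inv_cancel, one_rmul hr]

/-- Multiplication by `f` is an order automorphism of the elements below the rectangle, with inverse
multiplication by `f⁻¹`. -/
theorem isAtom_perm_rmul (f : PermGroup x) {a : A} (ha : IsAtom a) (hr : a ≤ rect x.1 y.1) :
    IsAtom (f.1 ⨾ a) := by
  refine ⟨rmul_ne_bot_of_le_rect f.2.1 ha.1 f.2.2.2 hr, fun b hb => ?_⟩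
  have hbr := hb.le.trans (perm_rmul_le_rect f hr)
  have h1 : (f⁻¹).1 ⨾ b ≤ a := by
    have := rmul_mono_right (f⁻¹).1 hb.le
    rwa [inv_rmul_cancel f hr] at this
  rcases ha.le_iff.1 h1 with h2 | h2
  · rw [← rmul_inv_cancel f hbr, h2, rmul_bot]
  · exact absurd (by rw [← h2, rmul_inv_cancel f hbr]) hb.ne

theorem isAtom_rmul_perm (g : PermGroup y) {a : A} (ha : IsAtom a) (hr : a ≤ rect x.1 y.1) :
    IsAtom (a ⨾ g.1) := by
  have := isAtom_conv (isAtom_perm_rmul g⁻¹ (isAtom_conv ha)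
    (conv_le_rect x.2.le_ident y.2.le_ident hr))
  rwa [conv_rmul, conv_conv, perm_val_inv, conv_conv] at this

/-- Any two atoms below a rectangle differ by an element of the group of the left side. -/
theorem exists_perm_rmul_eq {a b : A} (ha : IsAtom a) (hb : IsAtom b) (har : a ≤ rect x.1 y.1)
    (hbr : b ≤ rect x.1 y.1) : ∃ f : PermGroup x, f.1 ⨾ a = b := by
  -- Here `b = b;y ≤ b;(a˘;a) = (b;a˘);a`, and `b;a˘` lies in the square on `x`.
  have h1 : b ≤ rect x.1 x.1 ⨾ a := by
    have h2 := rmul_mono_right b (le_conv_rmul_of_le_rect ha.1 har)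
    rw [rmul_of_le_rect_right x.2.le_ident y.2.le_ident hbr, rmul_assoc] at h2
    exact h2.trans (rmul_mono_left a (rmul_le_rect x.2.le_ident y.2.le_ident x.2.le_ident hbr
      (conv_le_rect x.2.le_ident y.2.le_ident har)))
  -- Measurability of `x` enters: one function of the family already makes `f;a` meet `b`.
  obtain ⟨S, hS, hlub⟩ := x.2.square
  have h3 : (rect x.1 x.1 ⨾ a) ⊓ b ≠ ⊥ := by
    rw [inf_comm]; exact inf_ne_bot_of_isAtom_of_le hb h1
  obtain ⟨f, hf, h4⟩ := exists_rmul_inf_ne_bot_of_isLUB hlub h3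
  have hf0 : f ≠ ⊥ := by
    rintro rfl
    rw [bot_rmul, bot_inf_eq] at h4
    exact h4 rfl
  refine ⟨⟨f, hf0, hS f hf, hlub.1 hf⟩, ?_⟩
  have hat := isAtom_perm_rmul (⟨f, hf0, hS f hf, hlub.1 hf⟩ : PermGroup x) ha har
  exact eq_of_isAtom_of_le hat hb (le_of_isAtom_of_inf_ne_bot hat h4)

theorem exists_rmul_perm_eq {a b : A} (ha : IsAtom a) (hb : IsAtom b) (har : a ≤ rect x.1 y.1)
    (hbr : b ≤ rect x.1 y.1) : ∃ g : PermGroup y, a ⨾ g.1 = b := by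
  obtain ⟨f, hf⟩ := exists_perm_rmul_eq (isAtom_conv ha) (isAtom_conv hb)
    (conv_le_rect x.2.le_ident y.2.le_ident har) (conv_le_rect x.2.le_ident y.2.le_ident hbr)
  refine ⟨f⁻¹, ?_⟩
  have := congrArg RelOps.conv hf
  rwa [conv_rmul, conv_conv, conv_conv] at this

theorem exists_perm_rmul_eq_rmul (g : PermGroup y) {a : A} (ha : IsAtom a)
    (hr : a ≤ rect x.1 y.1) : ∃ f : PermGroup x, f.1 ⨾ a = a ⨾ g.1 :=
  exists_perm_rmul_eq ha (isAtom_rmul_perm g ha hr) hr (rmul_perm_le_rect g hr)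

theorem exists_rmul_eq_perm_rmul (f : PermGroup x) {a : A} (ha : IsAtom a)
    (hr : a ≤ rect x.1 y.1) : ∃ g : PermGroup y, f.1 ⨾ a = a ⨾ g.1 := by
  obtain ⟨g, hg⟩ := exists_rmul_perm_eq ha (isAtom_perm_rmul f ha hr) hr (perm_rmul_le_rect f hr)
  exact ⟨g, hg.symm⟩

theorem exists_perm_of_isAtom {a : A} (ha : IsAtom a) (hr : a ≤ rect x.1 x.1) :
    ∃ f : PermGroup x, f.1 = a := by
  obtain ⟨f, hf⟩ := exists_perm_rmul_eq x.2.isAtom ha (le_rect x.2.le_ident) hr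
  refine ⟨f, ?_⟩
  rw [← hf]
  exact (congrArg Subtype.val (mul_one f)).symm

/-- The atoms below `a;a˘` are the elements of the left stabilizer of the atom `a`. -/
theorem exists_stabilizer_left [IsAtomic A] {a c r : A} (ha : IsAtom a) (hr : a ≤ rect x.1 y.1)
    (hc : IsAtom c) (h : c ≤ a ⨾ (a˘ ⨾ r)) : ∃ f : PermGroup x, f.1 ⨾ a = a ∧ c ≤ f.1 ⨾ r := by
  rw [rmul_assoc] at h
  obtain ⟨u, hu, hua, hcu⟩ := exists_isAtom_le_left hc h
  obtain ⟨f, rfl⟩ := exists_perm_of_isAtom hu (hua.trans (rmul_le_rect x.2.le_ident y.2.le_ident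
    x.2.le_ident hr (conv_le_rect x.2.le_ident y.2.le_ident hr)))
  refine ⟨f, ?_, hcu⟩
  -- From `f ≤ a;a˘` the cycle law gives `a ≤ f;a`; both sides are atoms, hence equal.
  have h1 := le_rmul_conv_of_isAtom ha hu hua
  rw [conv_conv] at h1
  exact (eq_of_isAtom_of_le ha (isAtom_perm_rmul f ha hr) h1).symm

theorem exists_stabilizer_right [IsAtomic A] {a c r : A} (ha : IsAtom a) (hr : a ≤ rect x.1 y.1)
    (hc : IsAtom c) (h : c ≤ a˘ ⨾ (a ⨾ r)) : ∃ g : PermGroup y, a ⨾ g.1 = a ∧ c ≤ g.1 ⨾ r := by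
  have h1 : c ≤ a˘ ⨾ (a˘˘ ⨾ r) := by rwa [conv_conv]
  obtain ⟨g, hg, hcg⟩ := exists_stabilizer_left (isAtom_conv ha)
    (conv_le_rect x.2.le_ident y.2.le_ident hr) hc h1
  refine ⟨g, ?_, hcg⟩
  have h2 := congrArg RelOps.conv hg
  rw [conv_rmul, conv_conv, ← perm_val_inv] at h2
  conv_lhs => rw [← h2, ← rmul_mul, inv_mul_cancel, rmul_one hr]

end Perm

end RelAlg

/-! ## Semi-scaffolds and their group triples -/

namespace RelAlg

open IsRelationAlgebra

variable {A : Type u} [BooleanAlgebra A] [RelOps A] [IsRelationAlgebra A]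

/-- Turns `H_xy (f H_xz)`, the form in which `C_xyz` arises, into the coset `f (H_xy H_xz)` required
of a group triple. -/
theorem normal_mul_smul {G : Type u} [Group G] (N : Subgroup G) [N.Normal] (c : G) (S : Set G) :
    (N : Set G) * (c • S) = c • ((N : Set G) * S) := by
  ext g
  simp only [Set.mem_mul, Set.mem_smul_set, smul_eq_mul, SetLike.mem_coe]
  constructor
  · rintro ⟨n, hn, _, ⟨t, ht, rfl⟩, rfl⟩
    exact ⟨_, ⟨c⁻¹ * n * c, Subgroup.Normal.conj_mem' ‹_› n hn c, t, ht, rfl⟩, by group⟩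
  · rintro ⟨_, ⟨n, hn, t, ht, rfl⟩, rfl⟩
    exact ⟨c * n * c⁻¹, Subgroup.Normal.conj_mem ‹_› n hn c, _, ⟨t, ht, rfl⟩, by group⟩

open Classical in
theorem nonempty_semiScaffold [IsAtomic A] : Nonempty (SemiScaffold A) := by
  have key : ∀ x y : MAtom A, ∃ a : A, Linked x y → IsAtom a ∧ a ≤ rect x.1 y.1 := by
    intro x y
    by_cases h : Linked x y
    · obtain ⟨a, ha⟩ := (eq_bot_or_exists_atom_le _).resolve_left h
      exact ⟨a, fun _ => ha⟩
    · exact ⟨⊥, fun h' => absurd h' h⟩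
  choose c hc using key
  -- A well-ordering selects one of `(x,y)` and `(y,x)`; the atom is chosen there and its converse
  -- is used for the other pair.
  let lt : MAtom A → MAtom A → Prop := WellOrderingRel
  refine ⟨{
    a := fun {x y} _ => if x = y then x.1 else if lt x y then c x y else (c y x)˘
    isAtom := fun {x y} h => ?_
    le_rect := fun {x y} h => ?_
    diag := fun h => if_pos rfl
    symm := fun {x y} h h' => ?_ }⟩
  · split_ifs with h1 h2
    · exact x.2.isAtom
    · exact (hc x y h).1
    · exact isAtom_conv (hc y x (Linked.symm h)).1
  · split_ifs with h1 h2
    · subst h1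
      exact le_rect x.2.le_ident
    · exact (hc x y h).2
    · exact conv_le_rect y.2.le_ident x.2.le_ident (hc y x (Linked.symm h)).2
  · by_cases h1 : x = y
    · subst h1
      simp only [if_true]
      exact (conv_eq x.2.le_ident).symm
    · rw [if_neg h1, if_neg (Ne.symm h1)]
      rcases trichotomous_of (WellOrderingRel : MAtom A → MAtom A → Prop) x y with h2 | h2 | h2
      · have h3 : ¬ lt y x := fun h3 => asymm_of WellOrderingRel h2 h3
        rw [if_pos (show lt x y from h2), if_neg h3]
      · exact absurd h2 h1
      · have h3 : ¬ lt x y := fun h3 => asymm_of WellOrderingRel h2 h3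
        rw [if_pos (show lt y x from h2), if_neg h3, conv_conv]

/-! ### Stabilizers of an atom and the induced quotient isomorphism -/

section Triple

variable {x y : MAtom A} {a : A}

/-- The elements of `G_x` that fix `a` under multiplication on the left. -/
def leftStabilizer (hr : a ≤ rect x.1 y.1) : Subgroup (PermGroup x) where
  carrier := {f | f.1 ⨾ a = a}
  one_mem' := one_rmul hr
  mul_mem' {f g} hf hg := by
    change (f * g).1 ⨾ a = a
    rw [mul_rmul, show g.1 ⨾ a = a from hg, show f.1 ⨾ a = a from hf]
  inv_mem' {f} hf := by
    change (f⁻¹).1 ⨾ a = a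
    conv_lhs => rw [← show f.1 ⨾ a = a from hf, inv_rmul_cancel f hr]

/-- The elements of `G_y` that fix `a` under multiplication on the right. -/
def rightStabilizer (hr : a ≤ rect x.1 y.1) : Subgroup (PermGroup y) where
  carrier := {f | a ⨾ f.1 = a}
  one_mem' := rmul_one hr
  mul_mem' {f g} hf hg := by
    change a ⨾ (f * g).1 = a
    rw [rmul_mul, show a ⨾ f.1 = a from hf, show a ⨾ g.1 = a from hg]
  inv_mem' {f} hf := by
    change a ⨾ (f⁻¹).1 = a
    conv_lhs => rw [← show a ⨾ f.1 = a from hf, ← rmul_mul, mul_inv_cancel, rmul_one hr]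

theorem mem_leftStabilizer {hr : a ≤ rect x.1 y.1} {f : PermGroup x} :
    f ∈ leftStabilizer hr ↔ f.1 ⨾ a = a := Iff.rfl

theorem mem_rightStabilizer {hr : a ≤ rect x.1 y.1} {g : PermGroup y} :
    g ∈ rightStabilizer hr ↔ a ⨾ g.1 = a := Iff.rfl

/-- Left and right multiplication commute: with `f⁻¹;a = a;g`, any `n` fixing `a` also fixes `a;g =
f⁻¹;a`, so `f n f⁻¹` fixes `a`. -/
theorem normal_leftStabilizer (ha : IsAtom a) (hr : a ≤ rect x.1 y.1) :
    (leftStabilizer hr).Normal := by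
  refine ⟨fun n hn f => ?_⟩
  rw [mem_leftStabilizer] at hn ⊢
  obtain ⟨g, hg⟩ := exists_rmul_eq_perm_rmul f⁻¹ ha hr
  rw [mul_assoc, mul_rmul, mul_rmul, hg, rmul_assoc n.1, hn, ← hg, rmul_inv_cancel f hr]

theorem normal_rightStabilizer (ha : IsAtom a) (hr : a ≤ rect x.1 y.1) :
    (rightStabilizer hr).Normal := by
  refine ⟨fun n hn g => ?_⟩
  rw [mem_rightStabilizer] at hn ⊢
  obtain ⟨f, hf⟩ := exists_perm_rmul_eq_rmul g ha hr
  rw [rmul_mul, rmul_mul, ← hf, ← rmul_assoc f.1, hn, hf, ← rmul_mul, mul_inv_cancel,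
    rmul_one hr]

theorem inv_mul_mem_leftStabilizer_iff {hr : a ≤ rect x.1 y.1} {f g : PermGroup x} :
    f⁻¹ * g ∈ leftStabilizer hr ↔ f.1 ⨾ a = g.1 ⨾ a := by
  rw [mem_leftStabilizer, mul_rmul]
  constructor
  · intro h
    conv_lhs => rw [← h, rmul_inv_cancel f (perm_rmul_le_rect g hr)]
  · intro h
    rw [← h, inv_rmul_cancel f hr]

theorem inv_mul_mem_rightStabilizer_iff (ha : IsAtom a) {hr : a ≤ rect x.1 y.1}
    {f g : PermGroup y} : f⁻¹ * g ∈ rightStabilizer hr ↔ a ⨾ f.1 = a ⨾ g.1 := by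
  have := normal_rightStabilizer ha hr
  -- For a right action the natural quotient is `g f⁻¹`; normality allows the exchange with `f⁻¹ g`.
  rw [this.mem_comm_iff, mem_rightStabilizer, rmul_mul]
  constructor
  · intro h
    conv_lhs => rw [← h, ← rmul_mul, inv_mul_cancel, rmul_one (rmul_perm_le_rect g hr)]
  · intro h
    rw [← h, ← rmul_mul, mul_inv_cancel, rmul_one hr]

/-- The isomorphism between quotients determined by the equation `f;a = a;g`. -/
theorem exists_quotient_mulEquiv (ha : IsAtom a) (hr : a ≤ rect x.1 y.1)
    [(leftStabilizer hr).Normal] [(rightStabilizer hr).Normal] :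
    ∃ φ : (PermGroup x ⧸ leftStabilizer hr) ≃* (PermGroup y ⧸ rightStabilizer hr),
      ∀ (f : PermGroup x) (g : PermGroup y),
        φ (f : PermGroup x ⧸ leftStabilizer hr) = (g : PermGroup y ⧸ rightStabilizer hr) ↔
          f.1 ⨾ a = a ⨾ g.1 := by
  choose t ht using fun f : PermGroup x => exists_rmul_eq_perm_rmul f ha hr
  -- Modulo the stabilizer the choice of `t f` is immaterial. Multiplicativity is `f;(g;a) = f;(a;t
  -- g) = (a;t f);t g`, with no reversal of order.
  let T : PermGroup x →* PermGroup y ⧸ rightStabilizer hr := MonoidHom.mk'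
    (fun f => (t f : PermGroup y ⧸ rightStabilizer hr)) fun f g => by
      rw [← QuotientGroup.mk_mul, QuotientGroup.eq, inv_mul_mem_rightStabilizer_iff ha,
        ← ht, mul_rmul, ht g, rmul_assoc, ht f, rmul_mul]
  have hT : ∀ (f : PermGroup x) (g : PermGroup y),
      T f = (g : PermGroup y ⧸ rightStabilizer hr) ↔ f.1 ⨾ a = a ⨾ g.1 := by
    intro f g
    change (t f : PermGroup y ⧸ rightStabilizer hr) = g ↔ _
    rw [QuotientGroup.eq, inv_mul_mem_rightStabilizer_iff ha, ← ht]
  have hker : leftStabilizer hr = T.ker := by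
    ext f
    rw [MonoidHom.mem_ker, ← QuotientGroup.mk_one, hT, rmul_one hr, mem_leftStabilizer]
  have hsurj : Function.Surjective T := by
    intro k
    obtain ⟨g, rfl⟩ := QuotientGroup.mk_surjective k
    obtain ⟨f, hf⟩ := exists_perm_rmul_eq_rmul g ha hr
    exact ⟨f, (hT f g).2 hf⟩
  exact ⟨(QuotientGroup.quotientMulEquivOfEq hker).trans
    (QuotientGroup.quotientKerEquivOfSurjective T hsurj), hT⟩

end Triple

theorem linked_trans {x y z : MAtom A} (hxy : Linked x y) (hyz : Linked y z) :
    Linked x z :=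
  linked_of_le (rmul_ne_bot_of_le_rect hxy hyz le_rfl le_rfl)
    (rmul_le_rect x.2.le_ident y.2.le_ident z.2.le_ident le_rfl le_rfl)

/-- The product is non-zero, and any atom below it is a translate of `a_xz`. Such an `f` represents
`C_xyz`. -/
theorem exists_perm_rmul_le (s : SemiScaffold A) [IsAtomic A] {x y z : MAtom A}
    (hxy : Linked x y) (hyz : Linked y z) (hxz : Linked x z) :
    ∃ f : PermGroup x, f.1 ⨾ s.a hxz ≤ s.a hxy ⨾ s.a hyz := by
  obtain ⟨c, hc, hle⟩ := (eq_bot_or_exists_atom_le _).resolve_left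
    (rmul_ne_bot_of_le_rect (s.isAtom hxy).1 (s.isAtom hyz).1 (s.le_rect hxy) (s.le_rect hyz))
  obtain ⟨f, rfl⟩ := exists_perm_rmul_eq (s.isAtom hxz) hc (s.le_rect hxz)
    (hle.trans (rmul_le_rect x.2.le_ident y.2.le_ident z.2.le_ident (s.le_rect hxy)
      (s.le_rect hyz)))
  exact ⟨f, hle⟩

theorem exists_isAssociated [IsAtomic A] (s : SemiScaffold A) :
    ∃ F : GroupTriple (Linked (A := A)) (fun x : MAtom A => PermGroup x), IsAssociated s F := by
  have hnl : ∀ {x y : MAtom A} (h : Linked x y), (leftStabilizer (s.le_rect h)).Normal :=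
    fun h => normal_leftStabilizer (s.isAtom h) (s.le_rect h)
  have hnr : ∀ {x y : MAtom A} (h : Linked x y), (rightStabilizer (s.le_rect h)).Normal :=
    fun h => normal_rightStabilizer (s.isAtom h) (s.le_rect h)
  have heq : Equivalence (Linked (A := A)) := ⟨linked_refl, Linked.symm, linked_trans⟩
  choose φ hφ using fun (x y : MAtom A) (h : Linked x y) =>
    exists_quotient_mulEquiv (s.isAtom h) (s.le_rect h)
  choose c hc using fun (x y z : MAtom A) (hxy : Linked x y) (hyz : Linked y z) =>
    exists_perm_rmul_le s hxy hyz (heq.trans hxy hyz)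
  refine ⟨{
    equiv := heq
    H := fun h => leftStabilizer (s.le_rect h)
    K := fun h => rightStabilizer (s.le_rect h)
    φ := fun {x y} h => φ x y h
    C := fun {x y z} hxy hyz => (leftStabilizer (s.le_rect hxy) : Set (PermGroup x)) *
      (c x y z hxy hyz • (leftStabilizer (s.le_rect (heq.trans hxy hyz)) : Set (PermGroup x)))
    isCoset_C := fun {x y z} hxy hyz => ⟨c x y z hxy hyz, ?_⟩ },
    { mem_H := fun h f => Iff.rfl
      mem_K := fun h f => Iff.rfl
      φ_iff := fun {x y} h f g => hφ x y h f g
      C_eq := fun {x y z} hxy hyz hxz => ⟨c x y z hxy hyz, hc x y z hxy hyz, rfl⟩ }⟩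
  have := hnl hxy
  exact normal_mul_smul _ _ _

end RelAlg

/-! ## Associated triples are semi-frames -/

namespace IsAssociated

open RelAlg IsRelationAlgebra

variable {A : Type u} [BooleanAlgebra A] [RelOps A] [IsRelationAlgebra A] {s : SemiScaffold A}
  {F : GroupTriple (Linked (A := A)) (fun x : MAtom A => PermGroup x)} {x y z : MAtom A}

theorem mk_eq_mk_iff (hF : IsAssociated s F) (h : Linked x y) (f g : PermGroup x) :
    (f : PermGroup x ⧸ F.H h) = g ↔ f.1 ⨾ s.a h = g.1 ⨾ s.a h := by
  rw [QuotientGroup.eq, hF.mem_H, ← mem_leftStabilizer (hr := s.le_rect h),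
    inv_mul_mem_leftStabilizer_iff]

theorem mem_img (hF : IsAssociated s F) (h : Linked x y) (M : Set (PermGroup x))
    (k : PermGroup y) : k ∈ F.img h M ↔ ∃ g ∈ M, g.1 ⨾ s.a h = s.a h ⨾ k.1 := by
  simp only [GroupTriple.img, Set.mem_ofPred_eq, hF.φ_iff]

theorem mem_preimg (hF : IsAssociated s F) (h : Linked x y) (N : Set (PermGroup y))
    (g : PermGroup x) : g ∈ F.preimg h N ↔ ∃ k ∈ N, g.1 ⨾ s.a h = s.a h ⨾ k.1 := by
  simp only [GroupTriple.preimg, Set.mem_ofPred_eq, hF.φ_iff]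

/-- An element of the normal subgroup `H_xy` fixes all atoms `f;a_xy`. -/
theorem rmul_rmul_eq (hF : IsAssociated s F) (h : Linked x y) {n : PermGroup x}
    (hn : n ∈ F.H h) (f : PermGroup x) : n.1 ⨾ (f.1 ⨾ s.a h) = f.1 ⨾ s.a h := by
  have h1 := (hF.mem_H h _).1 (Subgroup.Normal.conj_mem' (F.normal_H h) n hn f)
  rw [mul_assoc, mul_rmul, mul_rmul] at h1
  conv_rhs => rw [← h1, rmul_inv_cancel f
    (perm_rmul_le_rect n (perm_rmul_le_rect f (s.le_rect h)))]

/-- The stabilizer of `f;a_xy` is `f H_xy f⁻¹`, which is `H_xy` by normality. -/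
theorem mem_H_of_rmul_rmul_eq (hF : IsAssociated s F) (h : Linked x y) {n f : PermGroup x}
    (hn : n.1 ⨾ (f.1 ⨾ s.a h) = f.1 ⨾ s.a h) : n ∈ F.H h := by
  have h1 : f⁻¹ * n * f ∈ F.H h := by
    rw [hF.mem_H, mul_assoc, mul_rmul, mul_rmul, hn, inv_rmul_cancel f (s.le_rect h)]
  have h2 := Subgroup.Normal.conj_mem (F.normal_H h) _ h1 f
  rwa [show f * (f⁻¹ * n * f) * f⁻¹ = n by group] at h2

variable [IsAtomic A]

/-- Two atoms `f;a_xz`, `g;a_xz` below `a_xy;a_yz` differ by an element of `H_xy`. -/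
theorem exists_mem_H_rmul_eq (hF : IsAssociated s F) (hxy : Linked x y) (hyz : Linked y z)
    (hxz : Linked x z) {f g : PermGroup x} (hf : f.1 ⨾ s.a hxz ≤ s.a hxy ⨾ s.a hyz)
    (hg : g.1 ⨾ s.a hxz ≤ s.a hxy ⨾ s.a hyz) :
    ∃ n ∈ F.H hxy, g.1 ⨾ s.a hxz = n.1 ⨾ (f.1 ⨾ s.a hxz) := by
  have hfa := isAtom_perm_rmul f (s.isAtom hxz) (s.le_rect hxz)
  have hga := isAtom_perm_rmul g (s.isAtom hxz) (s.le_rect hxz)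
  -- Solving for `a_yz` and substituting gives `g;a_xz ≤ a_xy;(a_xy˘;(f;a_xz))`, where the atoms of
  -- `a_xy;a_xy˘` stabilize `a_xy`.
  have h1 := le_conv_rmul_of_isAtom (s.isAtom hyz) hfa hf
  obtain ⟨n, hn, hle⟩ := exists_stabilizer_left (s.isAtom hxy) (s.le_rect hxy) hga
    (hg.trans (rmul_mono_right _ h1))
  refine ⟨n, (hF.mem_H _ _).2 hn, eq_of_isAtom_of_le hga ?_ hle⟩
  exact isAtom_perm_rmul n hfa (perm_rmul_le_rect f (s.le_rect hxz))

/-- The atoms below `a_xy;a_yz` are the `g;a_xz` with `g` in `C_xyz`. -/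
theorem mem_C (hF : IsAssociated s F) (hxy : Linked x y) (hyz : Linked y z) (hxz : Linked x z)
    (g : PermGroup x) : g ∈ F.C hxy hyz ↔ g.1 ⨾ s.a hxz ≤ s.a hxy ⨾ s.a hyz := by
  obtain ⟨f, hf, hC⟩ := hF.C_eq hxy hyz hxz
  rw [hC]
  simp only [Set.mem_mul, Set.mem_smul_set, smul_eq_mul, SetLike.mem_coe]
  constructor
  · rintro ⟨n, hn, _, ⟨m, hm, rfl⟩, rfl⟩
    rw [mul_rmul, mul_rmul, (hF.mem_H _ _).1 hm]
    have := rmul_mono_right n.1 hf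
    rwa [rmul_assoc n.1 (s.a hxy), (hF.mem_H _ _).1 hn] at this
  · intro hg
    obtain ⟨n, hn, h1⟩ := hF.exists_mem_H_rmul_eq hxy hyz hxz hf hg
    refine ⟨n, hn, _, ⟨(n * f)⁻¹ * g, ?_, rfl⟩, by group⟩
    rw [hF.mem_H, mul_rmul, h1, ← mul_rmul n,
      inv_rmul_cancel (n * f) (s.le_rect hxz)]

/-- Fix `f` in `C_xyz` and let `g;a_xy = a_xy;k`. If `g` is in `H_xy H_xz`, then `(g f);a_xz` lies
below both `a_xy;a_yz` and `a_xy;(k;a_yz)`, so `a_yz` and `k;a_yz` differ by an element of `K_xy`.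
If `k` is in `K_xy H_yz`, then `g` fixes `a_xy;a_yz`, so `g f` and `f` both lie in `C_xyz`. -/
theorem img_H_mul_H (hF : IsAssociated s F) (hxy : Linked x y) (hyz : Linked y z)
    (hxz : Linked x z) :
    F.img hxy ((F.H hxy : Set (PermGroup x)) * (F.H hxz : Set (PermGroup x))) =
      (F.K hxy : Set (PermGroup y)) * (F.H hyz : Set (PermGroup y)) := by
  obtain ⟨f, hf⟩ := exists_perm_rmul_le s hxy hyz hxz
  ext k
  rw [hF.mem_img]
  simp only [Set.mem_mul, SetLike.mem_coe]
  constructor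
  · rintro ⟨_, ⟨n, hn, m, hm, rfl⟩, hk⟩
    have hat := isAtom_perm_rmul (n * m * f) (s.isAtom hxz) (s.le_rect hxz)
    have hkat := isAtom_perm_rmul k (s.isAtom hyz) (s.le_rect hyz)
    have h1 : (n * m * f).1 ⨾ s.a hxz ≤ s.a hxy ⨾ s.a hyz := by
      rw [mul_assoc, mul_rmul, mul_rmul, hF.rmul_rmul_eq hxz hm]
      have := rmul_mono_right n.1 hf
      rwa [rmul_assoc n.1 (s.a hxy), (hF.mem_H _ _).1 hn] at this
    have h2 : (n * m * f).1 ⨾ s.a hxz ≤ s.a hxy ⨾ (k.1 ⨾ s.a hyz) := by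
      have := rmul_mono_right (n * m).1 hf
      rwa [rmul_assoc (n * m).1 (s.a hxy), hk, ← rmul_assoc, ← mul_rmul] at this
    have h3 := le_conv_rmul_of_isAtom hkat hat h2
    obtain ⟨k', hk', h4⟩ := exists_stabilizer_right (s.isAtom hxy) (s.le_rect hxy) hkat
      (h3.trans (rmul_mono_right _ h1))
    have h5 := eq_of_isAtom_of_le hkat
      (isAtom_perm_rmul k' (s.isAtom hyz) (s.le_rect hyz)) h4
    refine ⟨k', (hF.mem_K _ _).2 hk', k'⁻¹ * k, ?_, by group⟩
    rw [hF.mem_H, mul_rmul, h5, inv_rmul_cancel k' (s.le_rect hyz)]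
  · rintro ⟨k, hk, l, hl, rfl⟩
    obtain ⟨g, hg⟩ := exists_perm_rmul_eq_rmul (k * l) (s.isAtom hxy) (s.le_rect hxy)
    refine ⟨g, ?_, hg⟩
    have h1 : (g * f).1 ⨾ s.a hxz ≤ s.a hxy ⨾ s.a hyz := by
      have := rmul_mono_right g.1 hf
      rwa [rmul_assoc g.1 (s.a hxy), hg, rmul_mul, (hF.mem_K _ _).1 hk, ← rmul_assoc,
        (hF.mem_H _ _).1 hl, ← mul_rmul] at this
    obtain ⟨n, hn, h2⟩ := hF.exists_mem_H_rmul_eq hxy hyz hxz hf h1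
    refine ⟨n, hn, n⁻¹ * g, hF.mem_H_of_rmul_rmul_eq hxz (f := f) ?_, by group⟩
    rw [mul_rmul, ← mul_rmul g, h2, inv_rmul_cancel n (perm_rmul_le_rect f (s.le_rect hxz))]

/-- If `m` passes through `a_xy` as `k` and `k` through `a_yz` as `l`, then `m;(a_xy;a_yz) =
(a_xy;a_yz);l`. Comparing atoms `c;a_xz` below this product shows that `l` corresponds across `a_xz`
to some `c⁻¹ m d` with `c`, `d` in `C_xyz`. -/
theorem img_img (hF : IsAssociated s F) (hxy : Linked x y) (hyz : Linked y z)
    (hxz : Linked x z) (M : Set (PermGroup x)) :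
    F.img hyz (F.img hxy M) = F.img hxz ((F.C hxy hyz)⁻¹ * M * F.C hxy hyz) := by
  ext l
  simp only [hF.mem_img, Set.mem_mul, Set.mem_inv]
  constructor
  · rintro ⟨k, ⟨m, hm, hmk⟩, hkl⟩
    obtain ⟨f, hf⟩ := exists_perm_rmul_le s hxy hyz hxz
    obtain ⟨f', hf'⟩ := exists_perm_rmul_eq_rmul l (s.isAtom hxz) (s.le_rect hxz)
    have h1 : (m⁻¹ * (f * f')).1 ⨾ s.a hxz ≤ s.a hxy ⨾ s.a hyz := by
      have h2 := rmul_mono_left l.1 hf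
      rw [← rmul_assoc, ← rmul_assoc, ← hf', ← hkl, rmul_assoc (s.a hxy), ← hmk,
        ← rmul_assoc m.1] at h2
      have h3 := rmul_mono_right (m⁻¹).1 h2
      rw [inv_rmul_cancel m (rmul_le_rect x.2.le_ident y.2.le_ident z.2.le_ident
        (s.le_rect hxy) (s.le_rect hyz))] at h3
      rwa [mul_rmul, mul_rmul]
    refine ⟨f', ⟨f⁻¹ * m, ⟨f⁻¹, ?_, m, hm, rfl⟩, m⁻¹ * (f * f'),
      (hF.mem_C hxy hyz hxz _).2 h1, by group⟩, hf'⟩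
    rw [inv_inv]
    exact (hF.mem_C hxy hyz hxz _).2 hf
  · rintro ⟨_, ⟨_, ⟨c, hc, m, hm, rfl⟩, d, hd, rfl⟩, h⟩
    rw [hF.mem_C hxy hyz hxz] at hc hd
    obtain ⟨k, hk⟩ := exists_rmul_eq_perm_rmul m (s.isAtom hxy) (s.le_rect hxy)
    have hat := isAtom_perm_rmul (m * d) (s.isAtom hxz) (s.le_rect hxz)
    have hbl := isAtom_rmul_perm l (s.isAtom hyz) (s.le_rect hyz)
    have h1 : (m * d).1 ⨾ s.a hxz ≤ s.a hxy ⨾ (k.1 ⨾ s.a hyz) := by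
      have := rmul_mono_right m.1 hd
      rwa [rmul_assoc m.1 (s.a hxy), hk, ← rmul_assoc, ← mul_rmul] at this
    have h2 : (m * d).1 ⨾ s.a hxz ≤ s.a hxy ⨾ (s.a hyz ⨾ l.1) := by
      have h3 := rmul_mono_left l.1 hc
      rwa [← rmul_assoc, ← h, ← mul_rmul, ← rmul_assoc,
        show c⁻¹ * (c * m * d) = m * d by group] at h3
    have h3 := le_conv_rmul_of_isAtom hbl hat h2
    -- One atom lies below both `a_xy;(k;a_yz)` and `a_xy;(a_yz;l)`, so `a_yz;l` is `k;a_yz` up to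
    -- an element `k'` of `K_xy`. Replacing `k` by `k' k` does not change `a_xy;k`.
    obtain ⟨k', hk', h4⟩ := exists_stabilizer_right (s.isAtom hxy) (s.le_rect hxy) hbl
      (h3.trans (rmul_mono_right _ h1))
    rw [← mul_rmul] at h4
    refine ⟨k' * k, ⟨m, hm, ?_⟩, (eq_of_isAtom_of_le hbl
      (isAtom_perm_rmul _ (s.isAtom hyz) (s.le_rect hyz)) h4).symm⟩
    rw [rmul_mul, hk', hk]

theorem isSemiFrame (hF : IsAssociated s F) : F.IsSemiFrame where
  diag {x} h := by
    have h1 : ∀ f : PermGroup x, f.1 ⨾ s.a h = f.1 := fun f => by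
      rw [s.diag h]; exact congrArg Subtype.val (mul_one f)
    have h2 : ∀ f : PermGroup x, s.a h ⨾ f.1 = f.1 := fun f => by
      rw [s.diag h]; exact congrArg Subtype.val (one_mul f)
    refine ⟨?_, ?_, fun g => ?_⟩
    · ext f
      rw [hF.mem_H, h1, s.diag h, Subgroup.mem_bot]
      exact ⟨fun h => Subtype.ext h, fun h => congrArg Subtype.val h⟩
    · ext f
      rw [hF.mem_K, h2, s.diag h, Subgroup.mem_bot]
      exact ⟨fun h => Subtype.ext h, fun h => congrArg Subtype.val h⟩
    · rw [hF.φ_iff, h1, h2]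
  symm {x y} h h' := by
    refine ⟨?_, ?_, fun g k => ?_⟩
    · ext f
      rw [← inv_mem_iff, hF.mem_H, hF.mem_K, s.symm h h', perm_val_inv, ← conv_rmul]
      exact (Function.LeftInverse.injective (conv_conv (A := A))).eq_iff
    · ext f
      rw [← inv_mem_iff, hF.mem_H, hF.mem_K, s.symm h h', perm_val_inv, ← conv_rmul]
      exact (Function.LeftInverse.injective (conv_conv (A := A))).eq_iff
    · rw [hF.φ_iff, hF.φ_iff, s.symm h h']
      rw [← (Function.LeftInverse.injective (conv_conv (A := A))).eq_iff, conv_rmul, conv_rmul,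
        conv_conv, ← perm_val_inv, ← perm_val_inv]
      constructor
      · intro h1
        -- After taking converses the equations are `a;k⁻¹ = g⁻¹;a` and `g;a = a;k`; multiplying by
        -- `g` and `k` on the outside exchanges them.
        have h2 := congrArg (fun t => g.1 ⨾ t ⨾ k.1) h1
        beta_reduce at h2
        rw [rmul_inv_cancel g (s.le_rect h), rmul_assoc g.1, ← rmul_assoc (g.1 ⨾ s.a h),
          ← perm_val_mul, inv_mul_cancel,
          rmul_one (perm_rmul_le_rect g (s.le_rect h))] at h2
        exact h2
      · intro h1
        have h2 := congrArg (fun t => (g⁻¹).1 ⨾ t ⨾ (k⁻¹).1) h1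
        beta_reduce at h2
        rw [inv_rmul_cancel g (s.le_rect h), rmul_assoc (g⁻¹).1, ← rmul_assoc ((g⁻¹).1 ⨾ s.a h),
          ← perm_val_mul, mul_inv_cancel,
          rmul_one (perm_rmul_le_rect g⁻¹ (s.le_rect h))] at h2
        exact h2
  image hxy hyz hxz := hF.img_H_mul_H hxy hyz hxz
  comp hxy hyz hxz _ M _ := hF.img_img hxy hyz hxz M

end IsAssociated

/-! ## The isomorphism onto the coset relation algebra -/

namespace RelAlg

open IsRelationAlgebra

variable {A : Type u} [BooleanAlgebra A] [RelOps A] [IsRelationAlgebra A]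

/-- Measurability of the algebra enters: `c = 1';c` meets `x;c` for some measurable atom `x`, and
`x;c ≤ c`. -/
theorem exists_isMeasurableAtom_rmul_eq (hA : IsMeasurableAlgebra A) {c : A} (hc : IsAtom c) :
    ∃ x : MAtom A, x.1 ⨾ c = c := by
  obtain ⟨S, hS, hlub⟩ := hA
  have h1 : (RelOps.ident ⨾ c) ⊓ c ≠ ⊥ := by
    rw [ident_rmul, inf_idem]; exact hc.1
  obtain ⟨x, hx, h2⟩ := exists_rmul_inf_ne_bot_of_isLUB hlub h1
  refine ⟨⟨x, hS x hx⟩, le_antisymm ?_ (le_of_isAtom_of_inf_ne_bot hc (by rwa [inf_comm]))⟩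
  have := rmul_mono_left c (hS x hx).le_ident
  rwa [ident_rmul] at this

theorem exists_le_rect (hA : IsMeasurableAlgebra A) {c : A} (hc : IsAtom c) :
    ∃ x y : MAtom A, c ≤ rect x.1 y.1 := by
  obtain ⟨x, hx⟩ := exists_isMeasurableAtom_rmul_eq hA hc
  obtain ⟨y, hy⟩ := exists_isMeasurableAtom_rmul_eq hA (isAtom_conv hc)
  refine ⟨x, y, ?_⟩
  have h1 := congrArg RelOps.conv hy
  rw [conv_rmul, conv_conv, conv_eq y.2.le_ident] at h1
  rw [← h1, ← hx]
  exact rmul_rmul_le_rect _ _ _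

end RelAlg

/-! ### Atoms attached to pairs of group elements -/

namespace SemiScaffold

open RelAlg IsRelationAlgebra

variable {A : Type u} [BooleanAlgebra A] [RelOps A] [IsRelationAlgebra A] (s : SemiScaffold A)

/-- The atom `g˘;a_xy;k` determined by a pair of elements `g` of `G_x` and `k` of `G_y`. -/
def pairAtom {x y : MAtom A} (h : Linked x y) (g : PermGroup x) (k : PermGroup y) : A :=
  (g⁻¹).1 ⨾ (s.a h ⨾ k.1)

variable {x y : MAtom A}

theorem isAtom_pairAtom (h : Linked x y) (g : PermGroup x) (k : PermGroup y) :
    IsAtom (s.pairAtom h g k) :=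
  isAtom_perm_rmul _ (isAtom_rmul_perm k (s.isAtom h) (s.le_rect h))
    (rmul_perm_le_rect k (s.le_rect h))

theorem pairAtom_le_rect (h : Linked x y) (g : PermGroup x) (k : PermGroup y) :
    s.pairAtom h g k ≤ rect x.1 y.1 :=
  perm_rmul_le_rect _ (rmul_perm_le_rect k (s.le_rect h))

theorem pairAtom_conv (h : Linked x y) (h' : Linked y x) (g : PermGroup x) (k : PermGroup y) :
    s.pairAtom h' k g = (s.pairAtom h g k)˘ := by
  rw [pairAtom, pairAtom, conv_rmul, conv_rmul, s.symm h h', perm_val_inv, perm_val_inv,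
    conv_conv, rmul_assoc]

theorem exists_eq_perm_rmul (hA : IsMeasurableAlgebra A) {c : A} (hc : IsAtom c) :
    ∃ (x y : MAtom A) (h : Linked x y) (f : PermGroup x), c = f.1 ⨾ s.a h := by
  obtain ⟨x, y, hle⟩ := exists_le_rect hA hc
  have h := linked_of_le hc.1 hle
  obtain ⟨f, hf⟩ := exists_perm_rmul_eq (s.isAtom h) hc (s.le_rect h) hle
  exact ⟨x, y, h, f, hf.symm⟩

/-- A non-zero element below `1'` and `x;1;y` forces `x = y`. Then `a_xx = x` makes the atom `g⁻¹
k`, and the only element of `G_x` below `1'` is `x`. -/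
theorem pairAtom_le_ident_iff (h : Linked x y) (g : PermGroup x) (k : PermGroup y) :
    s.pairAtom h g k ≤ RelOps.ident ↔
      (⟨x, g⟩ : Σ x : MAtom A, PermGroup x) = ⟨y, k⟩ := by
  constructor
  · intro hle
    have hat := s.isAtom_pairAtom h g k
    have hr := s.pairAtom_le_rect h g k
    obtain rfl : x = y := by
      refine Subtype.ext (eq_of_rmul_ne_bot x.2 y.2 fun h0 => hat.1 (le_bot_iff.1 ?_))
      rw [← h0]
      conv_lhs => rw [← rmul_of_le_rect_left x.2.le_ident hr,
        ← rmul_of_le_rect_right x.2.le_ident y.2.le_ident hr, rmul_assoc]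
      have := rmul_mono_left y.1 (rmul_mono_right x.1 hle)
      rwa [rmul_ident] at this
    have h1 : s.pairAtom h g k = (g⁻¹ * k).1 := by
      rw [pairAtom, s.diag h, perm_val_mul]
      exact congrArg (fun t => (g⁻¹).1 ⨾ t) (congrArg Subtype.val (one_mul k))
    have h2 : (g⁻¹ * k).1 = x.1 :=
      eq_of_isAtom_of_le (h1 ▸ hat) x.2.isAtom
        (rect_inf_ident x.2.le_ident (g⁻¹ * k).2.2.2 (h1 ▸ hle))
    have h3 : g⁻¹ * k = 1 := Subtype.ext h2
    rw [inv_mul_eq_one.1 h3]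
  · intro he
    obtain ⟨rfl, he⟩ := Sigma.mk.inj he
    obtain rfl := eq_of_heq he
    rw [pairAtom, s.diag h]
    have h1 : (g⁻¹).1 ⨾ (x.1 ⨾ g.1) = x.1 := by
      have := congrArg Subtype.val (inv_mul_cancel g)
      rwa [← one_mul g, perm_val_mul, perm_val_mul, one_mul] at this
    rw [h1]
    exact x.2.le_ident

/-- The set of pairs whose atom lies below `r`. -/
def pairsBelow (r : A) : Set ((Σ x : MAtom A, PermGroup x) × (Σ x : MAtom A, PermGroup x)) :=
  {p | ∃ h : Linked p.1.1 p.2.1, s.pairAtom h p.1.2 p.2.2 ≤ r}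

end SemiScaffold

namespace IsAssociated

open RelAlg IsRelationAlgebra

variable {A : Type u} [BooleanAlgebra A] [RelOps A] [IsRelationAlgebra A] {s : SemiScaffold A}
  {F : GroupTriple (Linked (A := A)) (fun x : MAtom A => PermGroup x)} {x y z : MAtom A}

/-- Membership says `(g f);a_xy = a_xy;k`; cancelling `g` shows that an atomic relation is the fibre
of `pairAtom` over one atom. -/
theorem mem_atomRel_iff (hF : IsAssociated s F) (h : Linked x y) (f g : PermGroup x)
    (k : PermGroup y) :
    ((⟨x, g⟩, ⟨y, k⟩) : (Σ x : MAtom A, PermGroup x) × (Σ x : MAtom A, PermGroup x)) ∈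
      F.atomRel h (f : PermGroup x ⧸ F.H h) ↔ s.pairAtom h g k = f.1 ⨾ s.a h := by
  rw [GroupTriple.mem_atomRel, ← map_mul, ← QuotientGroup.mk_mul, eq_comm, hF.φ_iff, mul_rmul,
    SemiScaffold.pairAtom]
  constructor
  · intro h1
    rw [← h1, inv_rmul_cancel g (perm_rmul_le_rect f (s.le_rect h))]
  · intro h1
    rw [← h1, rmul_inv_cancel g (rmul_perm_le_rect k (s.le_rect h))]

/-- Atomic relations are non-empty, so their inclusion in a `pairsBelow` can be tested at a single
pair. -/
theorem exists_mem_atomRel (hF : IsAssociated s F) (h : Linked x y) (f : PermGroup x) :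
    ∃ k : PermGroup y, ((⟨x, 1⟩, ⟨y, k⟩) : (Σ x : MAtom A, PermGroup x) ×
      (Σ x : MAtom A, PermGroup x)) ∈ F.atomRel h (f : PermGroup x ⧸ F.H h) := by
  obtain ⟨k, hk⟩ := exists_rmul_eq_perm_rmul f (s.isAtom h) (s.le_rect h)
  refine ⟨k, ?_⟩
  rw [hF.mem_atomRel_iff, SemiScaffold.pairAtom, inv_one,
    one_rmul (rmul_perm_le_rect k (s.le_rect h)), hk]

theorem atomRel_subset_iff (hF : IsAssociated s F) (h : Linked x y) (f : PermGroup x) (r : A) :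
    F.atomRel h (f : PermGroup x ⧸ F.H h) ⊆ s.pairsBelow r ↔ f.1 ⨾ s.a h ≤ r := by
  constructor
  · intro h1
    obtain ⟨k, hk⟩ := hF.exists_mem_atomRel h f
    obtain ⟨h', hle⟩ := h1 hk
    rw [hF.mem_atomRel_iff] at hk
    rwa [← hk]
  · intro h1 p hp
    obtain ⟨g, k, rfl⟩ := GroupTriple.exists_of_mem hp
    rw [hF.mem_atomRel_iff] at hp
    exact ⟨h, hp.trans_le h1⟩

theorem pairsBelow_perm_rmul (hF : IsAssociated s F) (h : Linked x y) (f : PermGroup x) :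
    s.pairsBelow (f.1 ⨾ s.a h) = F.atomRel h (f : PermGroup x ⧸ F.H h) := by
  apply Set.Subset.antisymm
  · rintro ⟨⟨x', g⟩, ⟨y', k⟩⟩ ⟨h', hle⟩
    have hat := s.isAtom_pairAtom h' g k
    have hr := hle.trans (perm_rmul_le_rect f (s.le_rect h))
    obtain rfl := left_eq_of_le_rect hat.1 hr (s.pairAtom_le_rect h' g k)
    obtain rfl := right_eq_of_le_rect hat.1 hr (s.pairAtom_le_rect h' g k)
    rw [hF.mem_atomRel_iff]
    exact eq_of_isAtom_of_le hat (isAtom_perm_rmul f (s.isAtom h) (s.le_rect h)) hle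
  · exact (hF.atomRel_subset_iff h f _).2 le_rfl

theorem isUnionOfAtoms_pairsBelow (hF : IsAssociated s F) (r : A) :
    F.IsUnionOfAtoms (s.pairsBelow r) := by
  rw [GroupTriple.isUnionOfAtoms_iff]
  refine ⟨?_, ?_⟩
  · rintro ⟨⟨x, g⟩, ⟨y, k⟩⟩ ⟨h, -⟩
    exact GroupTriple.mem_unit h
  · rintro x y h α p hp ⟨h', hle⟩
    obtain ⟨f, rfl⟩ := QuotientGroup.mk_surjective α
    obtain ⟨g, k, rfl⟩ := GroupTriple.exists_of_mem hp
    rw [hF.mem_atomRel_iff] at hp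
    rw [hF.atomRel_subset_iff, ← hp]
    exact hle

/-! ### Relative multiplication and the isomorphism -/

variable [IsAtomic A]

/-- The product of two atoms in terms of cosets. -/
theorem subset_preimg_mul_C_iff (hF : IsAssociated s F) (hxy : Linked x y) (hyz : Linked y z)
    (hxz : Linked x z) (f g : PermGroup x) (k : PermGroup y) :
    {t : PermGroup x | (t : PermGroup x ⧸ F.H hxz) = g} ⊆
      F.preimg hxy ({l : PermGroup y | (l : PermGroup y ⧸ F.K hxy) = F.φ hxy f} *
        {l : PermGroup y | (l : PermGroup y ⧸ F.H hyz) = k}) * F.C hxy hyz ↔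
      g.1 ⨾ s.a hxz ≤ (f.1 ⨾ s.a hxy) ⨾ (k.1 ⨾ s.a hyz) := by
  constructor
  · intro h
    -- Testing at `g` alone: `g = d c` with `d;a_xy = a_xy;(l m)`, so `g;a_xz ≤ d;(a_xy;a_yz)`,
    -- which equals the required product.
    obtain ⟨d, hd, c, hc, hg⟩ := h (show (g : PermGroup x ⧸ F.H hxz) = g from rfl)
    rw [hF.mem_preimg] at hd
    obtain ⟨_, ⟨l, hl, m, hm, rfl⟩, hd⟩ := hd
    have hl' := (hF.φ_iff hxy f l).1 (Eq.symm hl)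
    have hm' := (hF.mk_eq_mk_iff hyz m k).1 hm
    have h1 := rmul_mono_right d.1 ((hF.mem_C hxy hyz hxz c).1 hc)
    have hg' : d * c = g := hg
    beta_reduce at hd
    rw [← mul_rmul, hg', rmul_assoc d.1 (s.a hxy), hd, rmul_mul, ← hl', ← rmul_assoc, hm'] at h1
    exact h1
  · intro h t ht
    have ht' := (hF.mk_eq_mk_iff hxz t g).1 ht
    rw [← ht'] at h
    -- Moving `k` left across `a_xy` makes the product `(f d);(a_xy;a_yz)`; hence `(f d)⁻¹ t` is in
    -- `C_xyz`.
    obtain ⟨d, hd⟩ := exists_perm_rmul_eq_rmul k (s.isAtom hxy) (s.le_rect hxy)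
    obtain ⟨l, hl⟩ := exists_rmul_eq_perm_rmul f (s.isAtom hxy) (s.le_rect hxy)
    rw [rmul_assoc, ← rmul_assoc f.1, ← hd, ← mul_rmul, ← rmul_assoc] at h
    have h1 := rmul_mono_right ((f * d)⁻¹).1 h
    rw [inv_rmul_cancel (f * d) (rmul_le_rect x.2.le_ident y.2.le_ident z.2.le_ident
      (s.le_rect hxy) (s.le_rect hyz)), ← mul_rmul] at h1
    refine ⟨f * d, ?_, (f * d)⁻¹ * t, (hF.mem_C hxy hyz hxz _).2 h1, mul_inv_cancel_left _ _⟩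
    rw [hF.mem_preimg]
    refine ⟨l * k, ⟨l, ((hF.φ_iff hxy f l).2 hl).symm, k, rfl, rfl⟩, ?_⟩
    rw [mul_rmul, hd, rmul_assoc, hl, rmul_mul]

theorem mem_atomMul_iff (hF : IsAssociated s F) (hxy : Linked x y) (hyz : Linked y z)
    (f : PermGroup x) (k : PermGroup y)
    (p : (Σ x : MAtom A, PermGroup x) × (Σ x : MAtom A, PermGroup x)) :
    p ∈ F.atomMul hxy hyz (f : PermGroup x ⧸ F.H hxy) (k : PermGroup y ⧸ F.H hyz) ↔
      p ∈ s.pairsBelow ((f.1 ⨾ s.a hxy) ⨾ (k.1 ⨾ s.a hyz)) := by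
  have hxz := F.equiv.trans hxy hyz
  simp only [GroupTriple.atomMul, Set.mem_iUnion, Set.mem_ofPred_eq]
  constructor
  · rintro ⟨γ, hγ, hp⟩
    obtain ⟨g, rfl⟩ := QuotientGroup.mk_surjective γ
    have h1 := (hF.subset_preimg_mul_C_iff hxy hyz hxz f g k).1 hγ
    exact (hF.atomRel_subset_iff hxz g _).2 h1 hp
  · obtain ⟨⟨x', g⟩, ⟨z', l⟩⟩ := p
    rintro ⟨h, hle⟩
    have hat := s.isAtom_pairAtom h g l
    have hr := hle.trans (rmul_le_rect x.2.le_ident y.2.le_ident z.2.le_ident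
      (perm_rmul_le_rect f (s.le_rect hxy)) (perm_rmul_le_rect k (s.le_rect hyz)))
    obtain rfl := left_eq_of_le_rect hat.1 hr (s.pairAtom_le_rect h g l)
    obtain rfl := right_eq_of_le_rect hat.1 hr (s.pairAtom_le_rect h g l)
    obtain ⟨t, ht⟩ := exists_perm_rmul_eq (s.isAtom hxz) hat (s.le_rect hxz) hr
    refine ⟨(t : PermGroup x ⧸ F.H hxz),
      (hF.subset_preimg_mul_C_iff hxy hyz hxz f t k).2 (ht.trans_le hle), ?_⟩
    rw [hF.mem_atomRel_iff]
    exact ht.symm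

theorem pairsBelow_rmul (hF : IsAssociated s F) (hA : IsMeasurableAlgebra A) (r t : A) :
    s.pairsBelow (r ⨾ t) = F.relMul (s.pairsBelow r) (s.pairsBelow t) := by
  ext p
  constructor
  · obtain ⟨⟨x, g⟩, ⟨z, l⟩⟩ := p
    rintro ⟨h, hle⟩
    have hat := s.isAtom_pairAtom h g l
    obtain ⟨b, c, hb, hc, hbr, hct, hbc⟩ := exists_isAtom_le_rmul hat hle
    obtain ⟨x', y, hxy, f, rfl⟩ := s.exists_eq_perm_rmul hA hb
    obtain ⟨y', z', hyz, k, rfl⟩ := s.exists_eq_perm_rmul hA hc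
    obtain rfl : y = y' := eq_of_rect_rmul_rect_ne_bot (perm_rmul_le_rect f (s.le_rect hxy))
      (perm_rmul_le_rect k (s.le_rect hyz)) fun h0 => hat.1 (le_bot_iff.1 (hbc.trans h0.le))
    exact ⟨x', y, z', hxy, hyz, f, k, (hF.atomRel_subset_iff hxy f r).2 hbr,
      (hF.atomRel_subset_iff hyz k t).2 hct, (hF.mem_atomMul_iff hxy hyz f k _).2 ⟨h, hbc⟩⟩
  · rintro ⟨x, y, z, hxy, hyz, α, β, hα, hβ, hp⟩
    obtain ⟨f, rfl⟩ := QuotientGroup.mk_surjective α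
    obtain ⟨k, rfl⟩ := QuotientGroup.mk_surjective β
    obtain ⟨h, hle⟩ := (hF.mem_atomMul_iff hxy hyz f k p).1 hp
    exact ⟨h, hle.trans (rmul_mono ((hF.atomRel_subset_iff hxy f r).1 hα)
      ((hF.atomRel_subset_iff hyz k t).1 hβ))⟩

/-- The isomorphism onto the coset algebra, sending `r` to the set of pairs below `r`. -/
def toCoset (hF : IsAssociated s F) (r : A) : CosetAlgebra F hF.isSemiFrame :=
  ⟨s.pairsBelow r, hF.isUnionOfAtoms_pairsBelow r⟩

theorem isRAHom_toCoset (hF : IsAssociated s F) (hA : IsMeasurableAlgebra A) :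
    IsRAHom hF.toCoset where
  map_sup r t := by
    refine Subtype.ext (Set.ext ?_)
    rintro ⟨⟨x, g⟩, ⟨y, k⟩⟩
    change _ ↔ _ ∨ _
    constructor
    · rintro ⟨h, hle⟩
      have hat := s.isAtom_pairAtom h g k
      by_cases hr : s.pairAtom h g k ≤ r
      · exact Or.inl ⟨h, hr⟩
      · refine Or.inr ⟨h, ?_⟩
        have hd := hat.not_le_iff_disjoint.1 hr
        exact hd.left_le_of_le_sup_left hle
    · rintro (⟨h, hle⟩ | ⟨h, hle⟩)
      · exact ⟨h, hle.trans le_sup_left⟩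
      · exact ⟨h, hle.trans le_sup_right⟩
  map_compl r := by
    refine Subtype.ext (Set.ext ?_)
    rintro ⟨⟨x, g⟩, ⟨y, k⟩⟩
    change _ ↔ _ ∈ F.unit ∧ _ ∉ s.pairsBelow r
    constructor
    · rintro ⟨h, hle⟩
      refine ⟨GroupTriple.mem_unit h, ?_⟩
      rintro ⟨_, hle'⟩
      exact ((s.isAtom_pairAtom h g k).not_le_iff_disjoint.2
        (le_compl_iff_disjoint_right.1 hle)) hle'
    · rintro ⟨⟨x', y', h, α, hp⟩, hn⟩
      obtain ⟨g', k', he⟩ := GroupTriple.exists_of_mem hp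
      rw [Prod.mk.injEq] at he
      obtain ⟨rfl, -⟩ := Sigma.mk.inj he.1
      obtain ⟨rfl, -⟩ := Sigma.mk.inj he.2
      refine ⟨h, le_compl_iff_disjoint_right.2 ?_⟩
      exact (s.isAtom_pairAtom h g k).not_le_iff_disjoint.1 fun hle => hn ⟨h, hle⟩
  map_rmul r t := Subtype.ext (hF.pairsBelow_rmul hA r t)
  map_conv r := by
    refine Subtype.ext (Set.ext ?_)
    rintro ⟨⟨x, g⟩, ⟨y, k⟩⟩
    change _ ↔ (⟨⟨y, k⟩, ⟨x, g⟩⟩ : (Σ x : MAtom A, PermGroup x) × (Σ x : MAtom A, PermGroup x)) ∈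
      s.pairsBelow r
    constructor
    · rintro ⟨h, hle⟩
      refine ⟨Linked.symm h, ?_⟩
      rw [s.pairAtom_conv h, conv_le_iff]
      exact hle
    · rintro ⟨h, hle⟩
      refine ⟨Linked.symm h, ?_⟩
      rw [s.pairAtom_conv h, conv_le_iff, conv_conv]
      exact hle
  map_ident := by
    refine Subtype.ext (Set.ext ?_)
    rintro ⟨⟨x, g⟩, ⟨y, k⟩⟩
    constructor
    · rintro ⟨h, hle⟩
      exact (s.pairAtom_le_ident_iff h g k).1 hle
    · intro he
      have he' : (⟨x, g⟩ : Σ x : MAtom A, PermGroup x) = ⟨y, k⟩ := he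
      obtain rfl : x = y := (Sigma.mk.inj he').1
      exact ⟨linked_refl x, (s.pairAtom_le_ident_iff (linked_refl x) g k).2 he'⟩

theorem injective_toCoset (hF : IsAssociated s F) (hA : IsMeasurableAlgebra A) :
    Function.Injective hF.toCoset := by
  have key : ∀ r t : A, s.pairsBelow r = s.pairsBelow t → r ≤ t := by
    intro r t h
    refine le_of_forall_isAtom_le fun c hc hcr => ?_
    obtain ⟨x, y, hxy, f, rfl⟩ := s.exists_eq_perm_rmul hA hc
    rwa [← hF.atomRel_subset_iff, ← h, hF.atomRel_subset_iff]
  intro r t h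
  have h' : s.pairsBelow r = s.pairsBelow t := congrArg Subtype.val h
  exact le_antisymm (key r t h') (key t r h'.symm)

theorem surjective_toCoset (hF : IsAssociated s F) (hcomplete : ∀ S : Set A, ∃ t, IsLUB S t) :
    Function.Surjective hF.toCoset := by
  rintro ⟨R, hR⟩
  obtain ⟨hsub, hclosed⟩ := GroupTriple.isUnionOfAtoms_iff.1 hR
  -- The preimage of `R` is the sum of the atoms whose relations are contained in `R`; an atom below
  -- this sum meets, hence equals, one of them.
  obtain ⟨r, hr⟩ := hcomplete {c | ∃ (x y : MAtom A) (h : Linked x y) (f : PermGroup x),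
    F.atomRel h (f : PermGroup x ⧸ F.H h) ⊆ R ∧ c = f.1 ⨾ s.a h}
  refine ⟨r, Subtype.ext (Set.Subset.antisymm ?_ ?_)⟩
  · rintro ⟨⟨x, g⟩, ⟨y, k⟩⟩ ⟨h, hle⟩
    have hat := s.isAtom_pairAtom h g k
    have h1 : r ⊓ s.pairAtom h g k ≠ ⊥ := by
      rw [inf_comm]; exact inf_ne_bot_of_isAtom_of_le hat hle
    obtain ⟨_, ⟨x', y', h', f, hf, rfl⟩, h2⟩ := exists_inf_ne_bot_of_isLUB hr h1
    rw [inf_comm] at h2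
    apply hf
    rw [← hF.pairsBelow_perm_rmul]
    exact ⟨h, le_of_isAtom_of_inf_ne_bot hat h2⟩
  · intro p hp
    obtain ⟨x, y, h, α, hα⟩ := hsub hp
    obtain ⟨f, rfl⟩ := QuotientGroup.mk_surjective α
    have h1 := hclosed x y h _ p hα hp
    exact (hF.atomRel_subset_iff h f r).2 (hr.1 ⟨x, y, h, f, h1, rfl⟩) hα

end IsAssociated

theorem theorem7 (B : Type u) [BooleanAlgebra B] [RelOps B] [IsRelationAlgebra B]
    (hatomic : IsAtomic B) (hmeas : IsMeasurableAlgebra B) :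
    (∃ (A : Type u) (_ : BooleanAlgebra A) (_ : RelOps A) (e : B → A), IsCompletion e) ∧
    ∀ (A : Type v) [BooleanAlgebra A] [RelOps A] [IsRelationAlgebra A] (e : B → A),
      IsCompletion e →
      Nonempty (SemiScaffold A) ∧
      ∀ s : SemiScaffold A,
        (∃ F : GroupTriple (Linked (A := A)) (fun x : MAtom A => PermGroup x),
          IsAssociated s F) ∧
        ∀ F : GroupTriple (Linked (A := A)) (fun x : MAtom A => PermGroup x),
          IsAssociated s F →
          ∃ hF : F.IsSemiFrame,
            IsRelationAlgebra (CosetAlgebra F hF) ∧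
            ∃ ψ : A ≃ CosetAlgebra F hF, IsRAHom ψ ∧
              ∀ (x y : MAtom A) (h : Linked x y) (f : PermGroup x),
                (ψ (f.1 ⨾ s.a h)).1 = F.atomRel h (f : PermGroup x ⧸ F.H h) := by
  refine ⟨⟨AtomSet B, inferInstance, inferInstance, AtomSet.below, AtomSet.isCompletion_below⟩, ?_⟩
  intro A _ _ _ e he
  have hA : IsAtomic A := he.isAtomic
  have hm : IsMeasurableAlgebra A := he.isMeasurableAlgebra hmeas
  refine ⟨RelAlg.nonempty_semiScaffold, fun s => ⟨RelAlg.exists_isAssociated s, fun F hF => ?_⟩⟩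
  have hom := hF.isRAHom_toCoset hm
  have hsurj := hF.surjective_toCoset he.complete
  exact ⟨hF.isSemiFrame, hom.isRelationAlgebra_of_surjective hsurj,
    Equiv.ofBijective hF.toCoset ⟨hF.injective_toCoset hm, hsurj⟩, hom,
    fun x y h f => hF.pairsBelow_perm_rmul h f⟩
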